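/- Let $\mathbb S^1=\mathbb R/\mathbb Z$, let $f:\mathbb S^1\times\mathbb R\to\mathbb R$ be smooth, and let $F:B^1\to B^0$, $F(u)(t)=u'(t)+f(t,u(t))$, where either $B^1=C^1(\mathbb S^1;\mathbb R)$, $B^0=C^0(\mathbb S^1;\mathbb R)$, or $B^1=H^1(\mathbb S^1;\mathbb R)$ (the periodic absolutely continuous functions with derivative in $L^2$), $B^0=L^2(\mathbb S^1;\mathbb R)$. All averages $\int$ are over $\mathbb S^1$. Let $\Psi:B^1\to B^0$, $\Psi(u)=F(u)-\int F(u)+\int u$. Put $\phi(z)=\int F(\Psi^{-1}(z))$ for $z\in\Psi(B^1)$, so that $F\circ\Psi^{-1}$ is $(\tilde v,\bar u)\mapsto(\tilde v,\phi(\tilde v,\bar u))$ in the decomposition of $B^0$ into functions of average zero and constants. Let $D_2$ denote differentiation in the direction of the constant function $1$, and let $$S_k=\{u\in B^1 : D_2\phi(\Psi(u))=\cdots=D_2^k\phi(\Psi(u))=0\},\qquad k\ge 0 .$$ For $v\in B^0$ the return map $\rho_v:I\to\mathbb R$ sends $w(0)$ to $w(1)$ whenever $w:[0,1]\to\mathbb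 R$ satisfies $w'(t)+f(t,w(t))=v(t)$ (classically in the first case; in the second case, $w$ is absolutely continuous and the equation holds almost everywhere); here $I$ is the set of initial conditions $w(0)$ of all such $w$. **Proposition 2.3.** Let $u\in B^1$ and $v=F(u)$. The objects above are well defined near $u$: $\Psi$ is injective, $\Psi(u)+s\in\Psi(B^1)$ for all small real $s$, and $s\mapsto\phi(\Psi(u)+s)$ is smooth at $s=0$; $\rho_v(w(0))=w(1)$ does not depend on the choice of the solution $w$, $I$ is a neighbourhood of $u(0)$, and $\rho_v$ is smooth at $u(0)$. (Here a function is smooth at a point if, for every $n$, it is $C^n$ in some neighbourhood of the point.) Moreover: 1. $\rho_v(u(0))=u(0)$. 2. For every $k\ge1$: $u\in S_k$ if and only if $\rho_v'(u(0))=1$ and $\rho_v^{(i)}(u(0))=0$ for $i=2,\dots,k$. In particular, $u\in S_1$ if and only if $\rho_v'(u(0))=1$. 3. The order of $u$, that is, the largest $k\ge 0$ with $u\in S_k$ ($\infty$ if there is no largest), equals the order of contact of $\rho_v$ with the identity at $u(0)$, that is, the largest $k\ge0$ such that the derivatives of $\rho_v$ and of the identity of every order $i\le k$ agree at $u(0)$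 ($\infty$ if there is no largest). -/

import Mathlib

open MeasureTheory Set
open scoped ContDiff Topology

namespace PeriodicODE

/-! Functions on the circle `ℝ / ℤ` are functions on `UnitAddCircle`; its `volume` has mass `1`. -/

/-- A smooth nonlinearity `f : 𝕊¹ × ℝ → ℝ`; smoothness is tested on the universal cover. -/
structure Nonlinearity where
  toFun : UnitAddCircle → ℝ → ℝ
  smooth : ContDiff ℝ ∞ (fun p : ℝ × ℝ => toFun (p.1 : UnitAddCircle) p.2)

instance : CoeFun Nonlinearity (fun _ => UnitAddCircle → ℝ → ℝ) := ⟨Nonlinearity.toFun⟩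

/-- The derivative of a function on the circle. -/
noncomputable def circleDeriv (u : UnitAddCircle → ℝ) (x : UnitAddCircle) : ℝ :=
  deriv (fun s : ℝ => u (x + (s : UnitAddCircle))) 0

/-- The differential expression `u'(t) + f(t, u(t))`. -/
noncomputable def odeOp (f : Nonlinearity) (u : UnitAddCircle → ℝ) (x : UnitAddCircle) : ℝ :=
  circleDeriv u x + f x (u x)

/-- The average `∫ g` over the circle. -/
noncomputable def mean (g : UnitAddCircle → ℝ) : ℝ := ∫ x, g x

theorem continuous_of_lift {g : UnitAddCircle → ℝ}
    (h : Continuous (fun t : ℝ => g (t : UnitAddCircle))) : Continuous g :=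
  isQuotientMap_quotient_mk'.continuous_iff.2 h

theorem circleDeriv_coe (u : UnitAddCircle → ℝ) (t : ℝ) :
    circleDeriv u (t : UnitAddCircle) = deriv (fun s : ℝ => u (s : UnitAddCircle)) t := by
  have h := deriv_comp_const_add (fun s : ℝ => u (s : UnitAddCircle)) t 0
  simpa [circleDeriv, AddCircle.coe_add] using h

theorem continuous_nemytskii (f : Nonlinearity) (u : C(UnitAddCircle, ℝ)) :
    Continuous (fun x => f x (u x)) := by
  apply continuous_of_lift
  have h : Continuous (fun t : ℝ => (t, u (t : UnitAddCircle))) :=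
    continuous_id.prodMk (u.continuous.comp (AddCircle.continuous_mk' 1))
  exact f.smooth.continuous.comp h

/-! ### The two choices of function spaces -/

/-- `C¹(𝕊¹; ℝ)`. -/
abbrev C1Circle : Type :=
  {u : C(UnitAddCircle, ℝ) // ContDiff ℝ 1 (fun t : ℝ => u (t : UnitAddCircle))}

/-- `H¹(𝕊¹; ℝ)`: the periodic absolutely continuous functions with derivative in `L²`. -/
abbrev H1Circle : Type :=
  {u : C(UnitAddCircle, ℝ) //
    AbsolutelyContinuousOnInterval (fun t : ℝ => u (t : UnitAddCircle)) 0 1 ∧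
      MemLp (circleDeriv u) 2 (volume : Measure UnitAddCircle)}

/-- `L²(𝕊¹; ℝ)`. -/
abbrev L2Circle : Type := Lp ℝ 2 (volume : Measure UnitAddCircle)

instance : Nonempty C1Circle := ⟨⟨0, by simpa using contDiff_const⟩⟩

instance : Nonempty H1Circle := by
  refine ⟨⟨0, ?_, ?_⟩⟩
  · have h : LipschitzOnWith 0 (fun _ : ℝ => (0 : ℝ)) (uIcc 0 1) :=
      (LipschitzWith.const (0 : ℝ)).lipschitzOnWith
    simpa using h.absolutelyContinuousOnInterval
  · have h : circleDeriv (0 : C(UnitAddCircle, ℝ)) = fun _ => (0 : ℝ) := by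
      funext x
      simp [circleDeriv]
    rw [h]
    exact memLp_const 0

/-- The operator `F : C¹ → C⁰`, `F(u)(t) = u'(t) + f(t, u(t))`. -/
noncomputable def opC (f : Nonlinearity) (u : C1Circle) : C(UnitAddCircle, ℝ) where
  toFun := odeOp f u.1
  continuous_toFun := by
    refine Continuous.add (continuous_of_lift ?_) (continuous_nemytskii f u.1)
    simp only [circleDeriv_coe]
    exact u.2.continuous_deriv le_rfl

theorem memLp_odeOp (f : Nonlinearity) (u : H1Circle) :
    MemLp (odeOp f u.1) 2 (volume : Measure UnitAddCircle) := by
  refine MemLp.add u.2.2 ?_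
  exact ContinuousMap.memLp volume ℝ (ContinuousMap.mk _ (continuous_nemytskii f u.1))

/-- The operator `F : H¹ → L²`, `F(u)(t) = u'(t) + f(t, u(t))`. -/
noncomputable def opH (f : Nonlinearity) (u : H1Circle) : L2Circle := (memLp_odeOp f u).toLp

/-! ### Adapted coordinates and the sets `S_k` -/

/-- The constant function `s`, as an element of `C⁰`. -/
noncomputable def constC (s : ℝ) : C(UnitAddCircle, ℝ) := ContinuousMap.const _ s

/-- The constant function `s`, as an element of `L²`. -/
noncomputable def constH (s : ℝ) : L2Circle := Lp.const 2 (volume : Measure UnitAddCircle) s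

/-- `Ψ : C¹ → C⁰`: the sum of the part of average zero of `F(u)` and the average of `u`. -/
noncomputable def psiC (f : Nonlinearity) (u : C1Circle) : C(UnitAddCircle, ℝ) :=
  opC f u - constC (mean (opC f u)) + constC (mean u.1)

/-- `Ψ : H¹ → L²`: the sum of the part of average zero of `F(u)` and the average of `u`. -/
noncomputable def psiH (f : Nonlinearity) (u : H1Circle) : L2Circle :=
  opH f u - constH (mean (opH f u)) + constH (mean u.1)

/-- `φ(z)` is the average of `F(Ψ⁻¹(z))`, so that `F ∘ Ψ⁻¹` is `(ṽ, ū) ↦ (ṽ, φ(ṽ, ū))`.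
It is meaningful for `z` in the image of the (injective) map `Ψ`. -/
noncomputable def phiC (f : Nonlinearity) (z : C(UnitAddCircle, ℝ)) : ℝ :=
  mean (opC f (Function.invFun (psiC f) z))

/-- The same function `φ` for the spaces `H¹` and `L²`. -/
noncomputable def phiH (f : Nonlinearity) (z : L2Circle) : ℝ :=
  mean (opH f (Function.invFun (psiH f) z))

/-- `S_k ⊆ C¹`: the points at which `D₂φ = ⋯ = D₂ᵏφ = 0` in adapted coordinates, where `D₂` is
the derivative in the direction of the constant functions. -/
def stratumC (f : Nonlinearity) (k : ℕ) : Set C1Circle :=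
  {u | ∀ i : ℕ, 1 ≤ i → i ≤ k → iteratedDeriv i (fun s : ℝ => phiC f (psiC f u + constC s)) 0 = 0}

/-- `S_k ⊆ H¹`. -/
def stratumH (f : Nonlinearity) (k : ℕ) : Set H1Circle :=
  {u | ∀ i : ℕ, 1 ≤ i → i ≤ k → iteratedDeriv i (fun s : ℝ => phiH f (psiH f u + constH s)) 0 = 0}

/-! ### The return map -/

/-- `w : [0,1] → ℝ` is a classical solution of `w'(t) + f(t, w(t)) = v(t)`, for continuous `v`.
Only the values of `w` on `[0,1]` matter. -/
def IsSolutionC (f : Nonlinearity) (v : C(UnitAddCircle, ℝ)) (w : ℝ → ℝ) : Prop :=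
  ∀ t ∈ Icc (0 : ℝ) 1, HasDerivWithinAt w (v t - f t (w t)) (Icc 0 1) t

/-- `w : [0,1] → ℝ` is a (Carathéodory) solution of `w'(t) + f(t, w(t)) = v(t)`, for `v ∈ L²`:
it is absolutely continuous and satisfies the equation almost everywhere.
Only the values of `w` on `[0,1]` matter. -/
def IsSolutionH (f : Nonlinearity) (v : L2Circle) (w : ℝ → ℝ) : Prop :=
  AbsolutelyContinuousOnInterval w 0 1 ∧
    ∀ᵐ t : ℝ ∂(volume.restrict (Icc (0 : ℝ) 1)), HasDerivAt w (v ((t : ℝ) : UnitAddCircle) - f t (w t)) t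

/-- The maximal domain `I`: the initial conditions whose solution extends to `t = 1`. -/
def returnDomain (sol : (ℝ → ℝ) → Prop) : Set ℝ := {c | ∃ w, sol w ∧ w 0 = c}

open Classical in
/-- The return map `w(0) ↦ w(1)`, with the value `0` outside its domain `I`. -/
noncomputable def returnMap (sol : (ℝ → ℝ) → Prop) (c : ℝ) : ℝ :=
  if h : ∃ w, sol w ∧ w 0 = c then h.choose 1 else 0

/-! ### Orders -/

/-- The largest `k` with `u ∈ S k` (possibly infinite). -/
noncomputable def stratumOrder {X : Type} (S : ℕ → Set X) (u : X) : ℕ∞ :=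
  ⨆ k ∈ {k : ℕ | u ∈ S k}, (k : ℕ∞)

/-- The order of contact at `x` of two functions smooth near `x` that agree at `x`: the largest
`k` such that their derivatives at `x` of all orders `i ≤ k` agree (possibly infinite). -/
noncomputable def contactOrder (g h : ℝ → ℝ) (x : ℝ) : ℕ∞ :=
  ⨆ k ∈ {k : ℕ | ∀ i ≤ k, iteratedDeriv i g x = iteratedDeriv i h x}, (k : ℕ∞)

end PeriodicODE

namespace PeriodicODE

/-! Subtracting the equation of the given periodic solution `u` removes `v`. A nearby `x` solves the
equation with forcing `v + l` exactly when `x - u` is a constant `c` plus the primitive of `f(τ, u)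
- f(τ, x) + l`. This is an identity in C([0,1]) with a continuous integrand, so the classical and
the Carathéodory case reduce to the same integral equation.

The inverse function theorem in C([0,1]) gives a smooth family of solutions `Y (c, l)`
(`exists_smooth_family`). Let `H (c, l)` consist of the increment of `Y (c, l)` over the period and
of its integral. At l = 0 the first component is the defect `ρ(u(0) + c) - u(0) - c`. The linearized
equation is scalar, d' = a d + l, and a periodic solution with a zero is trivial, with l = 0
(`linear_ode_periodic_eq_zero`). Hence `H` is a local diffeomorphism at 0, and b, the l-derivative
of its first component there, is nonzero.

Inverting `H` along (0, ∫u + s) produces a curve (C(s), L(s)) of periodic solutions, and φ(Ψ(u) + s)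
= ∫F(u) + L(s). The first component of `H` is zero at (C(s), L(s)), so at (C(s), 0) it equals -b
L(s) + o(L(s)). Since C'(0) ≠ 0, C is a local change of variable. The defect of the return map is
therefore o(c^k) if and only if L is o(s^k) (`exists_return_and_periodic_family`). By Taylor's
formula these are the vanishing conditions on derivatives in the proposition. -/

/-! ### Order of vanishing and Taylor expansion -/

theorem taylor_isLittleO_nhds {g : ℝ → ℝ} {x₀ : ℝ} (hg : ContDiffAt ℝ ∞ g x₀) (k : ℕ) :
    (fun x => g x - ∑ i ∈ Finset.range (k + 1),
      ((i.factorial : ℝ)⁻¹ * (x - x₀) ^ i) * iteratedDeriv i g x₀)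
      =o[𝓝 x₀] fun x => (x - x₀) ^ k := by
  have hg' : ContDiffAt ℝ k g x₀ := hg.of_le (by exact_mod_cast le_top)
  obtain ⟨U, hU, hgU⟩ := hg'.contDiffOn le_rfl (by simp)
  obtain ⟨r, hr, hrU⟩ := Metric.mem_nhds_iff.1 hU
  have hx : x₀ ∈ Metric.ball x₀ r := Metric.mem_ball_self hr
  have h := taylor_isLittleO (convex_ball x₀ r) hx (hgU.mono hrU)
  rw [Metric.isOpen_ball.nhdsWithin_eq hx] at h
  refine h.congr_left fun x => ?_
  rw [taylor_within_apply]
  congr 1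
  refine Finset.sum_congr rfl fun i _ => ?_
  rw [iteratedDerivWithin_of_isOpen Metric.isOpen_ball hx, smul_eq_mul]

/-- The little-o condition, unlike the one on derivatives, passes directly through changes of
variable and comparisons up to Θ, so no chain rule of higher order is needed. -/
theorem iteratedDeriv_eq_zero_iff_isLittleO {g : ℝ → ℝ} {x₀ : ℝ} (hg : ContDiffAt ℝ ∞ g x₀)
    (k : ℕ) :
    (∀ i ≤ k, iteratedDeriv i g x₀ = 0) ↔ g =o[𝓝 x₀] fun x => (x - x₀) ^ k := by
  constructor
  · intro h
    refine (taylor_isLittleO_nhds hg k).congr_left fun x => ?_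
    rw [Finset.sum_eq_zero, sub_zero]
    intro i hi
    rw [h i (Finset.mem_range_succ_iff.1 hi), mul_zero]
  · induction k with
    | zero =>
      intro h i hi
      obtain rfl : i = 0 := by omega
      simp only [pow_zero, Asymptotics.isLittleO_one_iff] at h
      simpa using tendsto_nhds_unique hg.continuousAt.tendsto h
    | succ k ih =>
      intro h
      have hlow : ∀ i ≤ k, iteratedDeriv i g x₀ = 0 := by
        refine ih (h.trans_isBigO ?_)
        have h1 : (fun x : ℝ => x - x₀) =O[𝓝 x₀] fun _ => (1 : ℝ) := by
          exact ((continuous_id.sub continuous_const).tendsto x₀).isBigO_one ℝ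
        simpa [pow_succ] using (Asymptotics.isBigO_refl (fun x : ℝ => (x - x₀) ^ k) _).mul h1
      intro i hi
      rcases Nat.lt_or_ge i (k + 1) with hik | hik
      · exact hlow i (by omega)
      obtain rfl : i = k + 1 := by omega
      -- Only the top term of the Taylor polynomial survives; being o((x - x₀)^(k+1)), its
      -- coefficient must vanish.
      have ht := h.sub (taylor_isLittleO_nhds hg (k + 1))
      have ht' : (fun x => (x - x₀) ^ (k + 1) *
          (((k + 1).factorial : ℝ)⁻¹ * iteratedDeriv (k + 1) g x₀))
          =o[𝓝 x₀] fun x => (x - x₀) ^ (k + 1) * 1 := by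
        refine ht.congr (fun x => ?_) fun x => (mul_one _).symm
        rw [Finset.sum_range_succ, Finset.sum_eq_zero]
        · ring
        · intro j hj
          rw [hlow j (by have := Finset.mem_range.1 hj; omega), mul_zero]
      have hlim := (ht'.mono (nhdsWithin_le_nhds (s := {x₀}ᶜ))).tendsto_div_nhds_zero
      have hc : ((k + 1).factorial : ℝ)⁻¹ * iteratedDeriv (k + 1) g x₀ = 0 := by
        refine tendsto_nhds_unique_of_eventuallyEq tendsto_const_nhds hlim ?_
        filter_upwards [self_mem_nhdsWithin] with x hx
        rw [mul_one, mul_div_cancel_left₀ _ (pow_ne_zero _ (sub_ne_zero.2 hx))]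
      exact (mul_eq_zero.1 hc).resolve_left (by positivity)

/-! ### Scalar linear equations on a period -/

/-- Variation of constants for a scalar linear equation. -/
theorem linear_ode_formula {a : ℝ → ℝ} (ha : Continuous a) (l : ℝ) :
    ∃ p q : ℝ → ℝ, (∀ t, 0 < p t) ∧ StrictMono q ∧ q 0 = 0 ∧
      ∀ d : ℝ → ℝ,
        (∀ t ∈ Icc (0 : ℝ) 1, HasDerivWithinAt d (a t * d t + l) (Icc 0 1) t) →
        ∀ t ∈ Icc (0 : ℝ) 1, d t = p t * (d 0 + l * q t) := by
  set A : ℝ → ℝ := fun t => ∫ τ in (0 : ℝ)..t, a τ with hA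
  have hAd : ∀ t, HasDerivAt A (a t) t := fun t => ha.integral_hasStrictDerivAt 0 t |>.hasDerivAt
  have hAc : Continuous A := continuous_iff_continuousAt.2 fun t => (hAd t).continuousAt
  have hec : Continuous fun t => Real.exp (-A t) := Real.continuous_exp.comp hAc.neg
  set B : ℝ → ℝ := fun t => ∫ τ in (0 : ℝ)..t, Real.exp (-A τ) with hB
  have hBd : ∀ t, HasDerivAt B (Real.exp (-A t)) t :=
    fun t => hec.integral_hasStrictDerivAt 0 t |>.hasDerivAt
  have hA0 : A 0 = 0 := by simp [hA]
  have hB0 : B 0 = 0 := by simp [hB]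
  refine ⟨fun t => Real.exp (A t), B, fun t => Real.exp_pos _, ?_, hB0, ?_⟩
  · refine strictMono_of_deriv_pos fun t => ?_
    rw [(hBd t).deriv]
    exact Real.exp_pos _
  · intro d hd t ht
    -- With the integrating factor `exp (-A)`, the derivative of this expression cancels
    -- identically.
    have hconst : Real.exp (-A t) * d t - l * B t = Real.exp (-A 0) * d 0 - l * B 0 := by
      refine constant_of_derivWithin_zero (f := fun t => Real.exp (-A t) * d t - l * B t)
        (a := 0) (b := 1) ?_ ?_ t ht
      · intro s hs
        exact ((((hAd s).neg.exp).hasDerivWithinAt.mul (hd s hs)).sub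
          ((hBd s).const_mul l).hasDerivWithinAt).differentiableWithinAt
      · intro s hs
        have hs' : s ∈ Icc (0 : ℝ) 1 := Ico_subset_Icc_self hs
        have h := (((hAd s).neg.exp).hasDerivWithinAt.mul (hd s hs')).sub
          ((hBd s).const_mul l).hasDerivWithinAt
        refine (h.congr_deriv ?_).derivWithin (uniqueDiffOn_Icc one_pos s hs')
        simp only [Pi.neg_apply]
        ring
    rw [hA0, hB0] at hconst
    have he : Real.exp (A t) * Real.exp (-A t) = 1 := by
      rw [← Real.exp_add]; simp
    simp only [neg_zero, Real.exp_zero, one_mul, mul_zero, sub_zero] at hconst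
    calc d t = (Real.exp (A t) * Real.exp (-A t)) * d t := by rw [he, one_mul]
      _ = Real.exp (A t) * (d 0 + l * B t) := by rw [← hconst]; ring

theorem linear_ode_eq_zero {a d : ℝ → ℝ} (ha : Continuous a)
    (hd : ∀ t ∈ Icc (0 : ℝ) 1, HasDerivWithinAt d (a t * d t) (Icc 0 1) t) (h0 : d 0 = 0) :
    ∀ t ∈ Icc (0 : ℝ) 1, d t = 0 := by
  obtain ⟨p, q, -, -, -, h⟩ := linear_ode_formula ha 0
  intro t ht
  simpa [h0] using h d (by simpa using hd) t ht

/-- A periodic solution with a zero of a scalar linear equation with constant forcing vanishes. -/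
theorem linear_ode_periodic_eq_zero {a d : ℝ → ℝ} {l : ℝ} (ha : Continuous a)
    (hd : ∀ t ∈ Icc (0 : ℝ) 1, HasDerivWithinAt d (a t * d t + l) (Icc 0 1) t)
    (hper : d 1 = d 0) (hz : ∃ t ∈ Icc (0 : ℝ) 1, d t = 0) :
    l = 0 ∧ ∀ t ∈ Icc (0 : ℝ) 1, d t = 0 := by
  obtain ⟨p, q, hp, hq, hq0, h⟩ := linear_ode_formula ha l
  obtain ⟨t₀, ht₀, hdt⟩ := hz
  have h1 := h d hd 1 (by simp)
  have h2 := h d hd t₀ ht₀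
  rw [hdt] at h2
  have h3 : d 0 = -(l * q t₀) := by
    have := (mul_eq_zero.1 h2.symm).resolve_left (hp t₀).ne'
    linarith
  have hle0 : 0 ≤ q t₀ := by rw [← hq0]; exact hq.monotone ht₀.1
  have hle1 : q t₀ ≤ q 1 := hq.monotone ht₀.2
  have h01 : 0 < q 1 := by rw [← hq0]; exact hq one_pos
  have hl : l = 0 := by
    have h4 : -(l * q t₀) = l * (p 1 * (q 1 - q t₀)) := by
      rw [← h3, ← hper, h1, h3]; ring
    have h5 : l * (p 1 * (q 1 - q t₀) + q t₀) = 0 := by linarith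
    -- The factor of `l` is positive: both summands are nonnegative, and if `q t₀ = 0` the first one
    -- is `p 1 * q 1 > 0`.
    refine (mul_eq_zero.1 h5).resolve_right ?_
    have h6 := mul_nonneg (hp 1).le (sub_nonneg.2 hle1)
    intro h7
    have h8 : q t₀ = 0 := by linarith
    rw [h8] at h7
    have := mul_pos (hp 1) h01
    simp at h7
    rcases h7 with h7 | h7
    · exact (hp 1).ne' h7
    · exact h01.ne' h7
  refine ⟨hl, fun t ht => ?_⟩
  rw [h d hd t ht, h3, hl]
  ring

/-! ### Smoothness of superposition operators -/

/-- Continuous functions on the unit interval. -/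
abbrev CInterval : Type := C(Icc (0 : ℝ) 1, ℝ)

/-- The superposition operator `w ↦ G(·, w(·))`. -/
def superposition (G : ℝ × ℝ → ℝ) (hG : Continuous G) (w : CInterval) : CInterval where
  toFun t := G (t, w t)
  continuous_toFun := hG.comp (by fun_prop)

theorem continuous_superposition (G : ℝ × ℝ → ℝ) (hG : Continuous G) :
    Continuous (superposition G hG) := by
  refine ContinuousMap.continuous_of_continuous_uncurry _ ?_
  exact hG.comp (by fun_prop : Continuous fun p : CInterval × Icc (0 : ℝ) 1 => ((p.2 : ℝ), p.1 p.2))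

/-- The partial derivative in the second variable. -/
noncomputable def partialSnd (G : ℝ × ℝ → ℝ) (p : ℝ × ℝ) : ℝ := fderiv ℝ G p (0, 1)

theorem contDiff_partialSnd {G : ℝ × ℝ → ℝ} (hG : ContDiff ℝ ∞ G) :
    ContDiff ℝ ∞ (partialSnd G) :=
  (hG.fderiv_right (m := ∞) (by simp)).clm_apply contDiff_const

theorem hasDerivAt_partialSnd {G : ℝ × ℝ → ℝ} (hG : ContDiff ℝ ∞ G) (t y : ℝ) :
    HasDerivAt (fun y => G (t, y)) (partialSnd G (t, y)) y := by
  have h1 : HasFDerivAt G (fderiv ℝ G (t, y)) (t, y) :=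
    (hG.differentiable (by simp) (t, y)).hasFDerivAt
  have h2 : HasDerivAt (fun y : ℝ => (t, y)) ((0 : ℝ), (1 : ℝ)) y :=
    (hasDerivAt_const y t).prodMk (hasDerivAt_id y)
  exact h1.comp_hasDerivAt y h2

/-- The mean value inequality is applied along the segment from `w t` to `w t + h t`. Uniformity in
`t` comes from the continuity, in the sup norm, of the superposition operator of the partial
derivative. -/
theorem hasFDerivAt_superposition {G : ℝ × ℝ → ℝ} (hG : ContDiff ℝ ∞ G) (w : CInterval) :
    HasFDerivAt (superposition G hG.continuous)
      (ContinuousLinearMap.mul ℝ CInterval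
        (superposition (partialSnd G) (contDiff_partialSnd hG).continuous w)) w := by
  set N := superposition (partialSnd G) (contDiff_partialSnd hG).continuous with hN
  rw [hasFDerivAt_iff_isLittleO_nhds_zero, Asymptotics.isLittleO_iff]
  intro ε hε
  have hc : ContinuousAt N w := (continuous_superposition _ _).continuousAt
  obtain ⟨δ, hδ, hδN⟩ := Metric.continuousAt_iff.1 hc ε hε
  filter_upwards [Metric.ball_mem_nhds (0 : CInterval) hδ] with h hh
  rw [mem_ball_zero_iff] at hh
  rw [ContinuousMap.norm_le _ (by positivity)]
  intro t
  have key := Convex.norm_image_sub_le_of_norm_hasDerivWithin_le (C := ε * ‖h‖) (x := 0) (y := 1)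
    (f := fun θ : ℝ => G (t, w t + θ * h t) - N w t * (θ * h t))
    (f' := fun θ : ℝ => partialSnd G (t, w t + θ * h t) * h t - N w t * h t)
    (s := Icc (0 : ℝ) 1) ?_ ?_ (convex_Icc 0 1) (by simp) (by simp)
  · have e : (superposition G hG.continuous (w + h) - superposition G hG.continuous w -
        (ContinuousLinearMap.mul ℝ CInterval (N w)) h) t =
        (G (t, w t + 1 * h t) - N w t * (1 * h t)) - (G (t, w t + 0 * h t) - N w t * (0 * h t)) := by
      simp [superposition]
      ring
    rw [e]
    simpa using key
  · intro θ _
    have h1 : HasDerivAt (fun θ : ℝ => w t + θ * h t) (h t) θ := by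
      simpa using ((hasDerivAt_id θ).mul_const (h t)).const_add (w t)
    have h2 := (hasDerivAt_partialSnd hG t (w t + θ * h t)).comp θ h1
    have h3 : HasDerivAt (fun θ : ℝ => N w t * (θ * h t)) (N w t * h t) θ := by
      simpa using ((hasDerivAt_id θ).mul_const (h t)).const_mul (N w t)
    exact (h2.sub h3).hasDerivWithinAt
  · intro θ hθ
    have hle : ‖θ • h‖ ≤ ‖h‖ := by
      rw [norm_smul, Real.norm_of_nonneg hθ.1]
      exact mul_le_of_le_one_left (norm_nonneg _) hθ.2
    have h1 : dist (N (w + θ • h)) (N w) < ε := by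
      refine hδN ?_
      rw [dist_eq_norm, add_sub_cancel_left]
      exact hle.trans_lt hh
    have h2 : ‖(N (w + θ • h) - N w) t‖ ≤ ε :=
      (ContinuousMap.norm_coe_le_norm _ t).trans (by rw [← dist_eq_norm]; exact h1.le)
    have e : partialSnd G (t, w t + θ * h t) * h t - N w t * h t
        = (N (w + θ • h) - N w) t * h t := by
      simp [hN, superposition]
      ring
    rw [e, norm_mul]
    exact mul_le_mul h2 (ContinuousMap.norm_coe_le_norm _ t) (norm_nonneg _) hε.le

/-- The derivative is multiplication by another superposition operator, that of `partialSnd G`, so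
regularity is gained by induction over all `G` at once. -/
theorem contDiff_superposition {G : ℝ × ℝ → ℝ} (hG : ContDiff ℝ ∞ G) :
    ContDiff ℝ ∞ (superposition G hG.continuous) := by
  refine contDiff_infty.2 fun n => ?_
  induction n generalizing G with
  | zero => exact contDiff_zero.2 (continuous_superposition _ _)
  | succ n ih =>
    refine contDiff_succ_iff_hasFDerivAt.2
      ⟨_, ?_, fun w => hasFDerivAt_superposition hG w⟩
    have h : ContDiff ℝ n (fun a : CInterval => ContinuousLinearMap.mul ℝ CInterval a) := by
      fun_prop
    exact h.comp (ih (contDiff_partialSnd hG))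

/-! ### Primitives and the linearized integral equation -/

/-- The extension of a function on `[0,1]` by constants. -/
noncomputable def ext (w : CInterval) : ℝ → ℝ := IccExtend zero_le_one w

theorem continuous_ext (w : CInterval) : Continuous (ext w) := w.continuous.Icc_extend'

theorem ext_apply (w : CInterval) (t : Icc (0 : ℝ) 1) : ext w t = w t :=
  IccExtend_val _ _ t

theorem ext_of_mem (w : CInterval) {t : ℝ} (ht : t ∈ Icc (0 : ℝ) 1) : ext w t = w ⟨t, ht⟩ :=
  IccExtend_of_mem _ _ ht

theorem abs_ext_le (w : CInterval) (t : ℝ) : ‖ext w t‖ ≤ ‖w‖ :=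
  ContinuousMap.norm_coe_le_norm w _

theorem continuous_primitive_ext (w : CInterval) :
    Continuous fun t : ℝ => ∫ τ in (0 : ℝ)..t, ext w τ :=
  intervalIntegral.continuous_primitive
    (fun a b => (continuous_ext w).intervalIntegrable a b) 0

/-- The primitive vanishing at `0`, as an operator on `C([0,1])`. -/
noncomputable def primitive : CInterval →L[ℝ] CInterval :=
  LinearMap.mkContinuous
    { toFun := fun w => ⟨fun t => ∫ τ in (0 : ℝ)..t, ext w τ,
        (continuous_primitive_ext w).comp continuous_subtype_val⟩
      map_add' := fun w w' => by
        ext t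
        simp only [ContinuousMap.coe_mk, ContinuousMap.add_apply]
        rw [← intervalIntegral.integral_add ((continuous_ext w).intervalIntegrable _ _)
          ((continuous_ext w').intervalIntegrable _ _)]
        rfl
      map_smul' := fun c w => by
        ext t
        simp only [ContinuousMap.coe_mk, ContinuousMap.smul_apply, RingHom.id_apply, smul_eq_mul]
        rw [← intervalIntegral.integral_const_mul]
        rfl } 1 (by
    intro w
    rw [one_mul, ContinuousMap.norm_le _ (norm_nonneg _)]
    intro t
    refine (intervalIntegral.norm_integral_le_of_norm_le_const
      (C := ‖w‖) fun τ _ => abs_ext_le w τ).trans ?_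
    rw [sub_zero, abs_of_nonneg t.2.1]
    exact mul_le_of_le_one_right (norm_nonneg _) t.2.2)

theorem primitive_apply (w : CInterval) (t : Icc (0 : ℝ) 1) :
    primitive w t = ∫ τ in (0 : ℝ)..t, ext w τ := rfl

/-- The inclusion of `[0,1]` in `ℝ`, as a function. -/
def coordinate : CInterval := ⟨Subtype.val, continuous_subtype_val⟩

/-- A solution of a linear integral equation solves the differential equation. -/
theorem hasDerivWithinAt_of_integral_eq {d : ℝ → ℝ} {q : ℝ → ℝ} (hq : Continuous q)
    (h : ∀ t ∈ Icc (0 : ℝ) 1, d t = d 0 + ∫ τ in (0 : ℝ)..t, q τ) :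
    ∀ t ∈ Icc (0 : ℝ) 1, HasDerivWithinAt d (q t) (Icc 0 1) t := by
  intro t ht
  have h1 : HasDerivAt (fun t => d 0 + ∫ τ in (0 : ℝ)..t, q τ) (q t) t :=
    (hq.integral_hasStrictDerivAt 0 t).hasDerivAt.const_add (d 0)
  exact h1.hasDerivWithinAt.congr h (h t ht)

theorem linear_integral_equation {a h y : CInterval} (hy : h + primitive (a * h) = y) :
    ∀ t ∈ Icc (0 : ℝ) 1, ext h t = ext y t + ∫ τ in (0 : ℝ)..t, (-ext a τ) * ext h τ := by
  intro t ht
  have := congrArg (fun w : CInterval => w ⟨t, ht⟩) hy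
  simp only [ContinuousMap.add_apply, primitive_apply] at this
  rw [ext_of_mem h ht, ext_of_mem y ht, ← this]
  have e : ∀ τ, (-ext a τ) * ext h τ = -ext (a * h) τ := fun τ => by
    simp [ext, IccExtend]
  simp [e]

/-- `h ↦ h + ∫ a h` is invertible. -/
theorem bijective_id_add_primitive_mul (a : CInterval) :
    Function.Bijective (ContinuousLinearMap.id ℝ CInterval +
      primitive.comp (ContinuousLinearMap.mul ℝ CInterval a)) := by
  constructor
  · rw [injective_iff_map_eq_zero]
    intro h hh
    have hh' : h + primitive (a * h) = 0 := by simpa using hh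
    have h1 := linear_integral_equation hh'
    have h00 : ext h 0 = 0 := by
      have := h1 0 (by simp)
      simpa [ext, IccExtend] using this
    have h2 : ∀ t ∈ Icc (0 : ℝ) 1, ext h t = ext h 0 + ∫ τ in (0 : ℝ)..t, (-ext a τ) * ext h τ := by
      intro t ht
      rw [h1 t ht, h00]
      simp [ext, IccExtend]
    have h3 := linear_ode_eq_zero (continuous_ext a).neg
      (hasDerivWithinAt_of_integral_eq ((continuous_ext a).neg.mul (continuous_ext h)) h2) h00
    ext t
    rw [← ext_apply]
    exact h3 t t.2
  · intro y
    -- Surjectivity: the preimage is `y - g`, where `g` must be the primitive of `a * (y - g)`. The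
    -- integrating factor `exp A` solves this linear equation explicitly.
    set A : ℝ → ℝ := fun t => ∫ τ in (0 : ℝ)..t, ext a τ with hA
    have hAd : ∀ t, HasDerivAt A (ext a t) t :=
      fun t => ((continuous_ext a).integral_hasStrictDerivAt 0 t).hasDerivAt
    have hAc : Continuous A := continuous_iff_continuousAt.2 fun t => (hAd t).continuousAt
    have hgc : Continuous fun τ => Real.exp (A τ) * (ext a τ * ext y τ) :=
      (Real.continuous_exp.comp hAc).mul ((continuous_ext a).mul (continuous_ext y))
    set q : ℝ → ℝ := fun t => ∫ τ in (0 : ℝ)..t, Real.exp (A τ) * (ext a τ * ext y τ) with hq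
    have hqd : ∀ t, HasDerivAt q (Real.exp (A t) * (ext a t * ext y t)) t :=
      fun t => (hgc.integral_hasStrictDerivAt 0 t).hasDerivAt
    have hqc : Continuous q := continuous_iff_continuousAt.2 fun t => (hqd t).continuousAt
    set g : ℝ → ℝ := fun t => Real.exp (-A t) * q t with hg
    have hgcont : Continuous g := (Real.continuous_exp.comp hAc.neg).mul hqc
    have hgd : ∀ t, HasDerivAt g (ext a t * (ext y t - g t)) t := by
      intro t
      have h1 := ((hAd t).neg.exp).mul (hqd t)
      refine h1.congr_deriv ?_
      have he : Real.exp (-A t) * Real.exp (A t) = 1 := by rw [← Real.exp_add]; simp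
      simp only [hg]
      linear_combination (ext a t * ext y t) * he
    refine ⟨y - ⟨fun t => g t, hgcont.comp continuous_subtype_val⟩, ?_⟩
    set h : CInterval := y - ⟨fun t => g t, hgcont.comp continuous_subtype_val⟩ with hh
    have hcont : Continuous fun t => ext a t * (ext y t - g t) := by
      have := continuous_ext a
      have := continuous_ext y
      fun_prop
    have hint : ∀ t ∈ Icc (0 : ℝ) 1, ∫ τ in (0 : ℝ)..t, ext (a * h) τ = g t := by
      intro t ht
      have h1 : ∫ τ in (0 : ℝ)..t, ext (a * h) τ = ∫ τ in (0 : ℝ)..t, ext a τ * (ext y τ - g τ) := by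
        refine intervalIntegral.integral_congr fun τ hτ => ?_
        rw [uIcc_of_le ht.1] at hτ
        have hτ' : τ ∈ Icc (0 : ℝ) 1 := ⟨hτ.1, hτ.2.trans ht.2⟩
        simp only [ext_of_mem _ hτ']
        rfl
      rw [h1, intervalIntegral.integral_eq_sub_of_hasDerivAt (fun τ _ => hgd τ)
        (hcont.intervalIntegrable _ _)]
      simp [hg, hq]
    ext t
    simp only [_root_.add_apply, ContinuousLinearMap.id_apply,
      ContinuousLinearMap.comp_apply, ContinuousLinearMap.mul_apply', ContinuousMap.add_apply,
      primitive_apply]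
    rw [hint t t.2]
    simp [hh]

/-! ### The nonlinear integral equation -/

/-- The operator `w ↦ w + ∫ G(τ, w(τ)) dτ` on `C([0,1])`. -/
noncomputable def integralOp (G : ℝ × ℝ → ℝ) (hG : Continuous G) (w : CInterval) : CInterval :=
  w + primitive (superposition G hG w)

theorem contDiff_integralOp {G : ℝ × ℝ → ℝ} (hG : ContDiff ℝ ∞ G) :
    ContDiff ℝ ∞ (integralOp G hG.continuous) :=
  contDiff_id.add (primitive.contDiff.comp (contDiff_superposition hG))

theorem hasFDerivAt_integralOp {G : ℝ × ℝ → ℝ} (hG : ContDiff ℝ ∞ G) (w : CInterval) :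
    HasFDerivAt (integralOp G hG.continuous) (ContinuousLinearMap.id ℝ CInterval +
      primitive.comp (ContinuousLinearMap.mul ℝ CInterval
        (superposition (partialSnd G) (contDiff_partialSnd hG).continuous w))) w :=
  (hasFDerivAt_id w).add (primitive.hasFDerivAt.comp w (hasFDerivAt_superposition hG w))

/-- Smooth dependence on the initial condition and on an additive constant, near a given
solution. -/
theorem exists_smooth_family {G : ℝ × ℝ → ℝ} (hG : ContDiff ℝ ∞ G) (w : CInterval) :
    ∃ (Y : ℝ × ℝ → CInterval) (Y' : ℝ × ℝ →L[ℝ] CInterval),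
      ContDiffAt ℝ ∞ Y 0 ∧ Y 0 = w ∧ HasFDerivAt Y Y' 0 ∧
      (∀ᶠ p in 𝓝 (0 : ℝ × ℝ), integralOp G hG.continuous (Y p) =
        integralOp G hG.continuous w + (p.1 • (1 : CInterval) + p.2 • coordinate)) ∧
      ∀ p : ℝ × ℝ, Y' p + primitive
        (superposition (partialSnd G) (contDiff_partialSnd hG).continuous w * Y' p) =
          p.1 • (1 : CInterval) + p.2 • coordinate := by
  set a := superposition (partialSnd G) (contDiff_partialSnd hG).continuous w with ha
  set Φ := integralOp G hG.continuous with hΦ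
  set D : CInterval ≃L[ℝ] CInterval := ContinuousLinearEquiv.ofBijective
    (ContinuousLinearMap.id ℝ CInterval +
      primitive.comp (ContinuousLinearMap.mul ℝ CInterval a))
    (LinearMap.ker_eq_bot.2 (bijective_id_add_primitive_mul a).1)
    (LinearMap.range_eq_top.2 (bijective_id_add_primitive_mul a).2) with hD
  have hcd : ContDiffAt ℝ ∞ Φ w := (contDiff_integralOp hG).contDiffAt
  have hderiv : HasFDerivAt Φ (D : CInterval →L[ℝ] CInterval) w := by
    have := hasFDerivAt_integralOp hG w
    rwa [hD, ContinuousLinearEquiv.coe_ofBijective]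
  have hs := hcd.hasStrictFDerivAt' hderiv (by simp)
  set K := hcd.localInverse hderiv (by simp) with hK
  -- Adding `c + l t` to the right side of the integral equation shifts the initial value by `c` and
  -- adds the constant forcing `l`.
  set ℓ : ℝ × ℝ →L[ℝ] CInterval :=
    (ContinuousLinearMap.fst ℝ ℝ ℝ).smulRight (1 : CInterval) +
      (ContinuousLinearMap.snd ℝ ℝ ℝ).smulRight coordinate with hℓ
  have hℓa : ∀ p : ℝ × ℝ, ℓ p = p.1 • (1 : CInterval) + p.2 • coordinate := fun p => by
    simp [hℓ]
  have hKd : HasFDerivAt K (D.symm : CInterval →L[ℝ] CInterval) (Φ w + ℓ 0) := by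
    rw [map_zero, add_zero]
    exact hs.to_localInverse.hasFDerivAt
  have hKc : ContDiffAt ℝ ∞ K (Φ w + ℓ 0) := by
    rw [map_zero, add_zero]
    exact hcd.to_localInverse hderiv (by simp)
  refine ⟨fun p => K (Φ w + ℓ p), (D.symm : CInterval →L[ℝ] CInterval).comp ℓ, ?_, ?_, ?_, ?_, ?_⟩
  · exact hKc.comp (0 : ℝ × ℝ) (contDiffAt_const.add ℓ.contDiff.contDiffAt)
  · simp only [map_zero, add_zero]
    exact hcd.localInverse_apply_image hderiv (by simp)
  · exact hKd.comp (0 : ℝ × ℝ) (ℓ.hasFDerivAt.const_add (Φ w))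
  · have h1 : ∀ᶠ y in 𝓝 (Φ w), Φ (K y) = y := hs.eventually_right_inverse
    have h2 : Filter.Tendsto (fun p => Φ w + ℓ p) (𝓝 0) (𝓝 (Φ w)) := by
      have hcont : Continuous fun p => Φ w + ℓ p := continuous_const.add ℓ.continuous
      have : Filter.Tendsto (fun p => Φ w + ℓ p) (𝓝 0) (𝓝 (Φ w + ℓ 0)) := hcont.tendsto 0
      rwa [map_zero, add_zero] at this
    filter_upwards [h2.eventually h1] with p hp
    rw [hp, hℓa]
  · intro p
    have := D.apply_symm_apply (ℓ p)
    rw [hℓa] at this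
    simpa [hD, hℓa] using this

/-! ### Differences of solutions and uniqueness -/

/-- Hadamard's lemma: the partial derivative is averaged over the segment from `x t` to `y t`. It
makes the difference of two nonlinear solutions solve a linear equation exactly, so that uniqueness
reduces to the linear case. -/
theorem exists_continuous_divided_difference {G : ℝ × ℝ → ℝ} (hG : ContDiff ℝ ∞ G)
    {x y : ℝ → ℝ} (hx : Continuous x) (hy : Continuous y) :
    ∃ a : ℝ → ℝ, Continuous a ∧ ∀ t, G (t, x t) - G (t, y t) = a t * (y t - x t) := by
  have hc : Continuous (partialSnd G) := (contDiff_partialSnd hG).continuous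
  refine ⟨fun t => -∫ θ in (0 : ℝ)..1, partialSnd G (t, x t + θ * (y t - x t)), ?_, fun t => ?_⟩
  · refine Continuous.neg ?_
    exact intervalIntegral.continuous_parametric_intervalIntegral_of_continuous' (by fun_prop) _ _
  · have hd : ∀ θ : ℝ, HasDerivAt (fun θ => G (t, x t + θ * (y t - x t)))
        (partialSnd G (t, x t + θ * (y t - x t)) * (y t - x t)) θ := by
      intro θ
      have h1 : HasDerivAt (fun θ : ℝ => x t + θ * (y t - x t)) (y t - x t) θ := by
        simpa using ((hasDerivAt_id θ).mul_const (y t - x t)).const_add (x t)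
      exact (hasDerivAt_partialSnd hG t _).comp θ h1
    have h := intervalIntegral.integral_eq_sub_of_hasDerivAt (a := 0) (b := 1) (fun θ _ => hd θ)
      ((by fun_prop : Continuous _).intervalIntegrable _ _)
    rw [intervalIntegral.integral_mul_const] at h
    simp only [one_mul, zero_mul, add_zero, add_sub_cancel] at h
    rw [neg_mul, h]
    ring

theorem hasDerivWithinAt_sub_of_integral_eq {G : ℝ × ℝ → ℝ} (hG : ContDiff ℝ ∞ G) {x y : ℝ → ℝ}
    (hx : Continuous x) (hy : Continuous y) {l : ℝ}
    (h : ∀ t ∈ Icc (0 : ℝ) 1, y t - x t = (y 0 - x 0) +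
      ∫ τ in (0 : ℝ)..t, (G (τ, x τ) - G (τ, y τ) + l)) :
    ∃ a : ℝ → ℝ, Continuous a ∧ ∀ t ∈ Icc (0 : ℝ) 1,
      HasDerivWithinAt (fun t => y t - x t) (a t * (y t - x t) + l) (Icc 0 1) t := by
  obtain ⟨a, ha, hxy⟩ := exists_continuous_divided_difference hG hx hy
  simp only [hxy] at h
  exact ⟨a, ha, hasDerivWithinAt_of_integral_eq (d := fun t => y t - x t)
    (q := fun t => a t * (y t - x t) + l) (by fun_prop) h⟩

theorem eq_of_integral_eq {G : ℝ × ℝ → ℝ} (hG : ContDiff ℝ ∞ G) {x y : ℝ → ℝ}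
    (hx : Continuous x) (hy : Continuous y)
    (h : ∀ t ∈ Icc (0 : ℝ) 1, y t - x t = (y 0 - x 0) +
      ∫ τ in (0 : ℝ)..t, (G (τ, x τ) - G (τ, y τ))) (h0 : y 0 = x 0) :
    ∀ t ∈ Icc (0 : ℝ) 1, y t = x t := by
  obtain ⟨a, ha, hd⟩ := hasDerivWithinAt_sub_of_integral_eq (l := 0) hG hx hy (by simpa using h)
  intro t ht
  exact sub_eq_zero.1 (linear_ode_eq_zero (d := fun t => y t - x t) ha (by simpa using hd) (sub_eq_zero.2 h0) t ht)

/-- The constant `l` is an unknown too. With `l` the difference of two averages of F, this yields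
the injectivity of Ψ. -/
theorem eq_of_integral_eq_of_periodic {G : ℝ × ℝ → ℝ} (hG : ContDiff ℝ ∞ G) {x y : ℝ → ℝ}
    (hx : Continuous x) (hy : Continuous y) {l : ℝ}
    (h : ∀ t ∈ Icc (0 : ℝ) 1, y t - x t = (y 0 - x 0) +
      ∫ τ in (0 : ℝ)..t, (G (τ, x τ) - G (τ, y τ) + l))
    (hper : y 1 - x 1 = y 0 - x 0) (hz : ∃ t ∈ Icc (0 : ℝ) 1, y t = x t) :
    l = 0 ∧ ∀ t ∈ Icc (0 : ℝ) 1, y t = x t := by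
  obtain ⟨a, ha, hd⟩ := hasDerivWithinAt_sub_of_integral_eq hG hx hy h
  obtain ⟨t₀, ht₀, hz⟩ := hz
  have := linear_ode_periodic_eq_zero ha hd hper ⟨t₀, ht₀, sub_eq_zero.2 hz⟩
  exact ⟨this.1, fun t ht => sub_eq_zero.1 (this.2 t ht)⟩

theorem exists_zero_of_integral_eq_zero {h : ℝ → ℝ} (hh : Continuous h)
    (hi : ∫ τ in (0 : ℝ)..1, h τ = 0) : ∃ t ∈ Icc (0 : ℝ) 1, h t = 0 := by
  have hd : ∀ t, HasDerivAt (fun t => ∫ τ in (0 : ℝ)..t, h τ) (h t) t :=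
    fun t => (hh.integral_hasStrictDerivAt 0 t).hasDerivAt
  obtain ⟨c, hc, hce⟩ := exists_hasDerivAt_eq_slope _ h one_pos
    (continuous_iff_continuousAt.2 fun t => (hd t).continuousAt).continuousOn (fun t _ => hd t)
  refine ⟨c, Ioo_subset_Icc_self hc, ?_⟩
  rw [hce, hi]
  simp

/-! ### Return map against periodic solutions with constant forcing -/

theorem linear_integral_equation_affine {a h : CInterval} {p : ℝ × ℝ}
    (hy : h + primitive (a * h) = p.1 • (1 : CInterval) + p.2 • coordinate) :
    ext h 0 = p.1 ∧ ∀ t ∈ Icc (0 : ℝ) 1,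
      HasDerivWithinAt (ext h) ((-ext a t) * ext h t + p.2) (Icc 0 1) t := by
  have h1 := linear_integral_equation hy
  have hya : ∀ t ∈ Icc (0 : ℝ) 1,
      ext (p.1 • (1 : CInterval) + p.2 • coordinate) t = p.1 + p.2 * t := fun t ht => by
    rw [ext_of_mem _ ht]
    simp [coordinate]
  have h0 : ext h 0 = p.1 := by
    rw [h1 0 (by simp), hya 0 (by simp)]
    simp
  refine ⟨h0, ?_⟩
  have hc : Continuous fun t => (-ext a t) * ext h t :=
    (continuous_ext a).neg.mul (continuous_ext h)
  refine hasDerivWithinAt_of_integral_eq (q := fun t => (-ext a t) * ext h t + p.2)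
    (hc.add continuous_const) fun t ht => ?_
  rw [h1 t ht, hya t ht, h0, intervalIntegral.integral_add (hc.intervalIntegrable _ _)
    intervalIntegrable_const]
  simp
  ring

theorem isTheta_of_sub_isLittleO {α : Type*} {l : Filter α} {f g : α → ℝ} {b : ℝ} (hb : b ≠ 0)
    (h : (fun x => f x - b * g x) =o[l] g) : f =Θ[l] g := by
  have h1 : (fun x => b * g x) =Θ[l] g :=
    ⟨(Asymptotics.isBigO_refl g l).const_mul_left b,
      (Asymptotics.isBigO_refl g l).const_mul_right hb⟩
  have h2 : Asymptotics.IsEquivalent l f (fun x => b * g x) := h.trans_isTheta h1.symm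
  exact h2.isTheta.trans h1

/-- The pair (increment over a period, integral over a period). -/
noncomputable def periodData : CInterval →L[ℝ] ℝ × ℝ :=
  ContinuousLinearMap.prod
    ((ContinuousMap.evalCLM ℝ 1 : CInterval →L[ℝ] ℝ) - ContinuousMap.evalCLM ℝ 0)
    ((ContinuousMap.evalCLM ℝ 1 : CInterval →L[ℝ] ℝ).comp primitive)

theorem periodData_apply (h : CInterval) : periodData h = (h 1 - h 0, primitive h 1) := rfl

theorem integralOp_apply {G : ℝ × ℝ → ℝ} (hG : Continuous G) (w : CInterval)
    (t : Icc (0 : ℝ) 1) :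
    integralOp G hG w t = w t + ∫ τ in (0 : ℝ)..t, G (τ, ext w τ) := by
  simp only [integralOp, ContinuousMap.add_apply, primitive_apply]
  congr 1
  refine intervalIntegral.integral_congr fun τ hτ => ?_
  rw [uIcc_of_le t.2.1] at hτ
  have hτ' : τ ∈ Icc (0 : ℝ) 1 := ⟨hτ.1, hτ.2.trans t.2.2⟩
  simp only [ext_of_mem _ hτ']
  rfl

theorem apply_zero_of_integralOp_eq {G : ℝ × ℝ → ℝ} {hG : Continuous G} {w x : CInterval}
    {c l : ℝ} (h : integralOp G hG x = integralOp G hG w +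
      (c • (1 : CInterval) + l • coordinate)) : x 0 = w 0 + c := by
  have := congrArg (fun y : CInterval => y 0) h
  simpa [integralOp_apply, coordinate] using this

/-- Near a periodic solution: the return map `w(0) + c ↦ w(0) + P c`, and the periodic solutions
with prescribed integral and a constant forcing `L s`. Both defects vanish to the same order. -/
theorem exists_return_and_periodic_family {G : ℝ × ℝ → ℝ} (hG : ContDiff ℝ ∞ G) {w : CInterval}
    (hw : w 1 = w 0) :
    ∃ P C L : ℝ → ℝ, ContDiffAt ℝ ∞ P 0 ∧ ContDiffAt ℝ ∞ L 0 ∧ L 0 = 0 ∧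
      (∀ᶠ c in 𝓝 (0 : ℝ), ∃ x : CInterval, integralOp G hG.continuous x =
        integralOp G hG.continuous w + (c • (1 : CInterval) + (0 : ℝ) • coordinate) ∧
          x 1 = w 1 + P c) ∧
      (∀ᶠ s in 𝓝 (0 : ℝ), ∃ x : CInterval, integralOp G hG.continuous x =
        integralOp G hG.continuous w + (C s • (1 : CInterval) + L s • coordinate) ∧
          x 1 = x 0 ∧ primitive x 1 = primitive w 1 + s) ∧
      ∀ k : ℕ, ((fun c => P c - c) =o[𝓝 0] fun c => c ^ k) ↔ L =o[𝓝 0] fun s => s ^ k := by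
  obtain ⟨Y, Y', hYc, hY0, hYd, hYe, hY'⟩ := exists_smooth_family hG w
  set T' : ℝ × ℝ →L[ℝ] ℝ × ℝ := periodData.comp Y' with hT'
  -- An element of the kernel gives a periodic solution of the linearized equation with integral
  -- zero, hence with a zero.
  have hinj : ∀ p, T' p = 0 → p = 0 := by
    intro p hp
    rw [hT', ContinuousLinearMap.comp_apply, periodData_apply, Prod.mk_eq_zero] at hp
    obtain ⟨h0, hd⟩ := linear_integral_equation_affine (hY' p)
    have hz := exists_zero_of_integral_eq_zero (continuous_ext (Y' p)) hp.2
    have hper : ext (Y' p) 1 = ext (Y' p) 0 := by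
      rw [ext_of_mem _ (by simp), ext_of_mem _ (by simp)]
      exact sub_eq_zero.1 hp.1
    obtain ⟨hl, hh⟩ := linear_ode_periodic_eq_zero (continuous_ext _).neg hd hper hz
    rw [Prod.ext_iff]
    exact ⟨by rw [← h0, hh 0 (by simp)]; rfl, hl⟩
  -- Here the solution starts at 0; were it periodic, its forcing 1 would have to vanish.
  have hb : (T' (0, 1)).1 ≠ 0 := by
    intro hp
    rw [hT', ContinuousLinearMap.comp_apply, periodData_apply] at hp
    obtain ⟨h0, hd⟩ := linear_integral_equation_affine (hY' (0, 1))
    have hper : ext (Y' (0, 1)) 1 = ext (Y' (0, 1)) 0 := by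
      rw [ext_of_mem _ (by simp), ext_of_mem _ (by simp)]
      exact sub_eq_zero.1 hp
    obtain ⟨hl, -⟩ := linear_ode_periodic_eq_zero (continuous_ext _).neg hd hper
      ⟨0, by simp, h0⟩
    exact one_ne_zero hl
  set D : (ℝ × ℝ) ≃L[ℝ] ℝ × ℝ := ContinuousLinearEquiv.ofBijective T'
    (LinearMap.ker_eq_bot'.2 hinj)
    (LinearMap.range_eq_top.2 (LinearMap.injective_iff_surjective.1
      ((injective_iff_map_eq_zero (T' : ℝ × ℝ →ₗ[ℝ] ℝ × ℝ)).2 hinj))) with hD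
  set H : ℝ × ℝ → ℝ × ℝ := fun p => periodData (Y p) with hH
  have hHc : ContDiffAt ℝ ∞ H 0 := periodData.contDiff.contDiffAt.comp 0 hYc
  have hHT : HasFDerivAt H T' 0 := periodData.hasFDerivAt.comp 0 hYd
  have hHd : HasFDerivAt H (D : ℝ × ℝ →L[ℝ] ℝ × ℝ) 0 := by
    rwa [hD, ContinuousLinearEquiv.coe_ofBijective]
  have hHs := hHc.hasStrictFDerivAt' hHd (by simp)
  have hHsT := hHc.hasStrictFDerivAt' hHT (by simp)
  set K := hHc.localInverse hHd (by simp) with hK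
  have hH0 : H 0 = (0, primitive w 1) := by
    simp [hH, hY0, periodData_apply, hw]
  set ι : ℝ → ℝ × ℝ := fun s => (0, primitive w 1 + s) with hι
  have hι0 : ι 0 = H 0 := by simp [hι, hH0]
  have hιd : HasDerivAt ι (0, 1) 0 :=
    (hasDerivAt_const _ _).prodMk ((hasDerivAt_id _).const_add _)
  have hιc : ContDiff ℝ ∞ ι := contDiff_const.prodMk (contDiff_const.add contDiff_id)
  -- The parameters (C s, L s) for which the increment over the period is 0 and the integral is
  -- raised by `s`.
  set R : ℝ → ℝ × ℝ := fun s => K (ι s) with hR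
  have hR0 : R 0 = 0 := by
    simp only [hR, hι0]
    exact hHc.localInverse_apply_image hHd (by simp)
  have hRc : ContDiffAt ℝ ∞ R 0 := by
    have h1 : ContDiffAt ℝ ∞ K (ι 0) := by
      rw [hι0]
      exact hHc.to_localInverse hHd (by simp)
    exact h1.comp 0 hιc.contDiffAt
  have hRd : HasDerivAt R (D.symm (0, 1)) 0 := by
    have h1 : HasFDerivAt K (D.symm : ℝ × ℝ →L[ℝ] ℝ × ℝ) (ι 0) := by
      rw [hι0]
      exact hHs.to_localInverse.hasFDerivAt
    exact h1.comp_hasDerivAt 0 hιd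
  have hRt : Filter.Tendsto R (𝓝 0) (𝓝 0) := by
    have := hRc.continuousAt.tendsto
    rwa [hR0] at this
  have hHR : ∀ᶠ s in 𝓝 (0 : ℝ), H (R s) = ι s := by
    have h1 : ∀ᶠ y in 𝓝 (ι 0), H (K y) = y := by
      rw [hι0]
      exact hHs.eventually_right_inverse
    exact hιc.continuous.continuousAt.eventually h1
  set C : ℝ → ℝ := fun s => (R s).1 with hC
  set L : ℝ → ℝ := fun s => (R s).2 with hL
  have hCc : ContDiffAt ℝ ∞ C 0 := contDiff_fst.contDiffAt.comp 0 hRc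
  have hLc : ContDiffAt ℝ ∞ L 0 := contDiff_snd.contDiffAt.comp 0 hRc
  set c₁ : ℝ := (D.symm (0, 1)).1 with hc₁
  have hCd : HasDerivAt C c₁ 0 :=
    (ContinuousLinearMap.fst ℝ ℝ ℝ).hasFDerivAt.comp_hasDerivAt 0 hRd
  -- Otherwise `R` is tangent to the l-axis at 0, along which the increment has nonzero derivative,
  -- while along `R` the increment stays 0.
  have hc₁0 : c₁ ≠ 0 := by
    intro h
    have h1 : T' (D.symm (0, 1)) = (0, 1) := by
      exact D.apply_symm_apply (0, 1)
    have h2 : D.symm (0, 1) = (D.symm (0, 1)).2 • ((0 : ℝ), (1 : ℝ)) := by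
      rw [Prod.ext_iff]
      exact ⟨by simpa using h, by simp⟩
    have h3 : (D.symm (0, 1)).2 * (T' (0, 1)).1 = 0 := by
      have := congrArg Prod.fst h1
      rw [h2, map_smul] at this
      simpa using this
    have h4 := (mul_eq_zero.1 h3).resolve_right hb
    rw [h4, zero_smul] at h2
    rw [h2, map_zero] at h1
    simpa using congrArg Prod.snd h1
  have hC0 : C 0 = 0 := by simp [hC, hR0]
  have hL0 : L 0 = 0 := by simp [hL, hR0]
  have hCs : HasStrictDerivAt C c₁ 0 := hCc.hasStrictDerivAt' hCd (by simp)
  have hCmap : Filter.map C (𝓝 0) = 𝓝 0 := by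
    have := hCs.map_nhds_eq hc₁0
    rwa [hC0] at this
  have hCθ : C =Θ[𝓝 0] fun s : ℝ => s := by
    refine isTheta_of_sub_isLittleO hc₁0 ?_
    have := hCd.isLittleO
    simpa [hC0, mul_comm] using this
  set j : ℝ → ℝ × ℝ := fun c => (c, 0) with hj
  have hjc : ContDiff ℝ ∞ j := contDiff_id.prodMk contDiff_const
  have hj0 : j 0 = 0 := rfl
  have hYjc : ContDiffAt ℝ ∞ (fun c => Y (j c)) 0 :=
    ContDiffAt.comp (g := Y) (f := j) 0 hYc hjc.contDiffAt
  have hPc : ContDiffAt ℝ ∞ (fun c => Y (j c) 1 - w 1) 0 :=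
    ((ContinuousMap.evalCLM ℝ (1 : Icc (0 : ℝ) 1)).contDiff.contDiffAt.comp 0 hYjc).sub
      contDiffAt_const
  have hYj := hjc.continuous.continuousAt.eventually (hYe : ∀ᶠ p in 𝓝 (j 0), _)
  have hPQ : (fun c => (Y (j c) 1 - w 1) - c) =ᶠ[𝓝 0] fun c => (H (j c)).1 := by
    filter_upwards [hYj] with c hc
    have h0 : Y (j c) 0 = w 0 + c := apply_zero_of_integralOp_eq hc
    simp only [hH, periodData_apply, h0, hw]
    ring
  -- The points `R s` and `j (C s)` differ by `L s` in the second coordinate only. Strict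
  -- differentiability of `H` compares its values at these two moving points with error o(L), and
  -- the increment at `R s` is 0.
  have hQL : (fun s => (H (j (C s))).1) =Θ[𝓝 0] L := by
    refine isTheta_of_sub_isLittleO (neg_ne_zero.2 hb) ?_
    have h1 := hHsT.isLittleO
    have h2 : Filter.Tendsto (fun s => (R s, j (C s))) (𝓝 0) (𝓝 ((0 : ℝ × ℝ), (0 : ℝ × ℝ))) := by
      refine hRt.prodMk_nhds ?_
      have h3 : ContinuousAt (fun s => j (C s)) 0 :=
        hjc.continuous.continuousAt.comp hCc.continuousAt
      have := h3.tendsto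
      rwa [hC0, hj0] at this
    have h3 := (h1.comp_tendsto h2)
    have h4 : ∀ s, R s - j (C s) = L s • ((0 : ℝ), (1 : ℝ)) := fun s => by
      rw [Prod.ext_iff]
      simp [hj, hC, hL]
    have h5 := (Asymptotics.isBigO_fst_prod (l := 𝓝 (0 : ℝ))
      (f' := fun s => (H (R s) - H (j (C s)) - T' (R s - j (C s))).1)
      (g' := fun s => (H (R s) - H (j (C s)) - T' (R s - j (C s))).2)).trans_isLittleO h3
    have h6 : (fun s => R s - j (C s)) =O[𝓝 0] L := by
      simp only [h4]
      exact Asymptotics.IsBigO.of_bound 1 (Filter.Eventually.of_forall fun s => by simp)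
    refine (h5.trans_isBigO h6).neg_left.congr' ?_ Filter.EventuallyEq.rfl
    filter_upwards [hHR] with s hs
    rw [hs, h4, map_smul]
    simp [hι]
    ring
  refine ⟨fun c => Y (j c) 1 - w 1, C, L, hPc, hLc, hL0, ?_, ?_, fun k => ?_⟩
  · filter_upwards [hYj] with c hc
    exact ⟨Y (j c), hc, by ring⟩
  · filter_upwards [hHR, hRt.eventually hYe] with s hs hs'
    refine ⟨Y (R s), hs', ?_⟩
    simp only [hH, periodData_apply, hι, Prod.mk.injEq] at hs
    exact ⟨sub_eq_zero.1 hs.1, hs.2⟩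
  · rw [Asymptotics.isLittleO_congr hPQ Filter.EventuallyEq.rfl]
    -- Substituting c = C(s) loses nothing, because C maps the neighbourhood filter of 0 onto
    -- itself.
    nth_rewrite 1 [← hCmap]
    rw [Asymptotics.isLittleO_map]
    have h1 : (fun s => (C s) ^ k) =Θ[𝓝 0] fun s : ℝ => s ^ k := hCθ.pow k
    exact h1.isLittleO_congr_right.trans hQL.isLittleO_congr_left

/-! ### From the circle to a period and back -/

/-- The lift of the nonlinearity to the universal cover. -/
def Nonlinearity.lift (f : Nonlinearity) (p : ℝ × ℝ) : ℝ := f (p.1 : UnitAddCircle) p.2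

theorem Nonlinearity.contDiff_lift (f : Nonlinearity) : ContDiff ℝ ∞ f.lift := f.smooth

theorem continuous_lift (u : C(UnitAddCircle, ℝ)) :
    Continuous fun t : ℝ => u (t : UnitAddCircle) :=
  u.continuous.comp (AddCircle.continuous_mk' 1)

/-- The restriction to a period. -/
def onPeriod (u : C(UnitAddCircle, ℝ)) : CInterval :=
  ⟨fun t => u ((t : ℝ) : UnitAddCircle), (continuous_lift u).comp continuous_subtype_val⟩

theorem ext_onPeriod (u : C(UnitAddCircle, ℝ)) {t : ℝ} (ht : t ∈ Icc (0 : ℝ) 1) :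
    ext (onPeriod u) t = u (t : UnitAddCircle) := ext_of_mem _ ht

theorem coe_one_eq_coe_zero : ((1 : ℝ) : UnitAddCircle) = ((0 : ℝ) : UnitAddCircle) := by
  simp

theorem onPeriod_one (u : C(UnitAddCircle, ℝ)) : onPeriod u 1 = onPeriod u 0 :=
  congrArg u coe_one_eq_coe_zero

theorem mean_eq_integral (u : C(UnitAddCircle, ℝ)) :
    mean u = ∫ t in (0 : ℝ)..1, u (t : UnitAddCircle) := by
  have := UnitAddCircle.intervalIntegral_preimage 0 u
  rw [zero_add] at this
  exact this.symm

theorem mean_eq_primitive (u : C(UnitAddCircle, ℝ)) : mean u = primitive (onPeriod u) 1 := by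
  rw [mean_eq_integral, primitive_apply]
  refine intervalIntegral.integral_congr fun τ hτ => ?_
  have hτ' : τ ∈ Icc (0 : ℝ) 1 := by simpa using hτ
  exact (ext_onPeriod u hτ').symm

theorem eq_of_eqOn_period {u v : C(UnitAddCircle, ℝ)}
    (h : ∀ t ∈ Icc (0 : ℝ) 1, u (t : UnitAddCircle) = v (t : UnitAddCircle)) : u = v := by
  ext x
  have hx : x ∈ ((↑) : ℝ → UnitAddCircle) '' Icc 0 (0 + 1) := by
    rw [AddCircle.coe_image_Icc_eq]; trivial
  obtain ⟨t, ht, rfl⟩ := hx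
  rw [zero_add] at ht
  exact h t ht

/-- The integral form of the equation satisfied by the difference of `w` and `u`. -/
noncomputable def defect (f : Nonlinearity) (u : C(UnitAddCircle, ℝ)) (w : CInterval) (l t : ℝ) :
    ℝ :=
  ∫ τ in (0 : ℝ)..t, (f.lift (τ, u (τ : UnitAddCircle)) - f.lift (τ, ext w τ) + l)

theorem continuous_defect_integrand (f : Nonlinearity) (u : C(UnitAddCircle, ℝ)) (w : CInterval)
    (l : ℝ) : Continuous fun τ : ℝ =>
      f.lift (τ, u (τ : UnitAddCircle)) - f.lift (τ, ext w τ) + l := by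
  have h1 := f.contDiff_lift.continuous
  have h2 := continuous_lift u
  have h3 := continuous_ext w
  fun_prop

theorem hasDerivAt_defect (f : Nonlinearity) (u : C(UnitAddCircle, ℝ)) (w : CInterval)
    (l t : ℝ) : HasDerivAt (defect f u w l)
      (f.lift (t, u (t : UnitAddCircle)) - f.lift (t, ext w t) + l) t :=
  ((continuous_defect_integrand f u w l).integral_hasStrictDerivAt 0 t).hasDerivAt

/-- The right-hand side `v` enters only through `u`, and the correction to `u` is C¹ even when `u`
is merely absolutely continuous. -/
theorem integralOp_eq_iff (f : Nonlinearity) (u : C(UnitAddCircle, ℝ)) (w : CInterval)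
    (c l : ℝ) :
    integralOp f.lift f.contDiff_lift.continuous w =
      integralOp f.lift f.contDiff_lift.continuous (onPeriod u) +
        (c • (1 : CInterval) + l • coordinate) ↔
    ∀ t ∈ Icc (0 : ℝ) 1, ext w t = u (t : UnitAddCircle) + (c + defect f u w l t) := by
  have h1 := f.contDiff_lift.continuous
  have h2 := continuous_lift u
  have h3 := continuous_ext w
  have hi1 : ∀ t, IntervalIntegrable (fun τ : ℝ => f.lift (τ, u (τ : UnitAddCircle))) volume 0 t :=
    fun t => (by fun_prop : Continuous _).intervalIntegrable _ _
  have hi2 : ∀ t, IntervalIntegrable (fun τ : ℝ => f.lift (τ, ext w τ)) volume 0 t :=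
    fun t => (by fun_prop : Continuous _).intervalIntegrable _ _
  have hd : ∀ t, defect f u w l t = (∫ τ in (0 : ℝ)..t, f.lift (τ, u (τ : UnitAddCircle))) -
      (∫ τ in (0 : ℝ)..t, f.lift (τ, ext w τ)) + l * t := by
    intro t
    rw [defect, intervalIntegral.integral_add ((hi1 t).sub (hi2 t)) intervalIntegrable_const,
      intervalIntegral.integral_sub (hi1 t) (hi2 t)]
    simp [mul_comm]
  have hu : ∀ t : Icc (0 : ℝ) 1, integralOp f.lift h1 (onPeriod u) t =
      u ((t : ℝ) : UnitAddCircle) + ∫ τ in (0 : ℝ)..t, f.lift (τ, u (τ : UnitAddCircle)) := by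
    intro t
    rw [integralOp_apply]
    congr 1
    refine intervalIntegral.integral_congr fun τ hτ => ?_
    rw [uIcc_of_le t.2.1] at hτ
    simp only [ext_onPeriod u ⟨hτ.1, hτ.2.trans t.2.2⟩]
  have key : ∀ t : Icc (0 : ℝ) 1, integralOp f.lift h1 w t =
      (integralOp f.lift h1 (onPeriod u) + (c • (1 : CInterval) + l • coordinate)) t ↔
      ext w t = u ((t : ℝ) : UnitAddCircle) + (c + defect f u w l t) := by
    intro t
    rw [ContinuousMap.add_apply, hu, integralOp_apply, hd, ← ext_apply w t]
    simp only [ContinuousMap.add_apply, ContinuousMap.smul_apply, ContinuousMap.one_apply,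
      coordinate, ContinuousMap.coe_mk, smul_eq_mul, mul_one]
    constructor <;> intro h <;> linarith
  rw [ContinuousMap.ext_iff, forall_congr' key]
  exact ⟨fun h t ht => h ⟨t, ht⟩, fun h t => h t t.2⟩

theorem integralOp_eq_of_const (f : Nonlinearity) (u : C(UnitAddCircle, ℝ)) (w : CInterval)
    (l : ℝ) (h : ∃ K, ∀ t ∈ Icc (0 : ℝ) 1,
      ext w t - u (t : UnitAddCircle) - defect f u w l t = K) :
    integralOp f.lift f.contDiff_lift.continuous w =
      integralOp f.lift f.contDiff_lift.continuous (onPeriod u) +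
        ((w 0 - u 0) • (1 : CInterval) + l • coordinate) := by
  obtain ⟨K, hK⟩ := h
  rw [integralOp_eq_iff]
  have h0 : w 0 - u 0 = K := by
    rw [← hK 0 (by simp), ext_of_mem w (by simp)]
    simp [defect]
  intro t ht
  rw [h0, ← hK t ht]
  ring

theorem injective_integralOp {G : ℝ × ℝ → ℝ} (hG : ContDiff ℝ ∞ G) :
    Function.Injective (integralOp G hG.continuous) := by
  intro w x h
  have h0 : x 0 = w 0 := by
    have := apply_zero_of_integralOp_eq (c := 0) (l := 0) (by simpa using h.symm)
    simpa using this
  have hc := hG.continuous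
  have hw := continuous_ext w
  have hx := continuous_ext x
  have key := eq_of_integral_eq hG (continuous_ext w) (continuous_ext x) (fun t ht => ?_) (by
    rw [ext_of_mem _ (by simp), ext_of_mem _ (by simp)]; exact h0)
  · ext t
    rw [← ext_apply, ← ext_apply]
    exact (key t t.2).symm
  · rw [intervalIntegral.integral_sub
      ((by fun_prop : Continuous _).intervalIntegrable _ _)
      ((by fun_prop : Continuous _).intervalIntegrable _ _)]
    have h1 := congrArg (fun y : CInterval => y ⟨t, ht⟩) h
    simp only [integralOp_apply] at h1
    have h2 : ext x 0 = ext w 0 := by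
      rw [ext_of_mem _ (by simp), ext_of_mem _ (by simp)]; exact h0
    rw [h2, ext_of_mem w ht, ext_of_mem x ht]
    linarith

/-- Equal averages force `v - u` to vanish somewhere, which is the zero needed for uniqueness among
periodic solutions. -/
theorem eq_of_integralOp_eq_of_mean_eq (f : Nonlinearity) {u v : C(UnitAddCircle, ℝ)} {l : ℝ}
    (h : integralOp f.lift f.contDiff_lift.continuous (onPeriod v) =
      integralOp f.lift f.contDiff_lift.continuous (onPeriod u) +
        ((v 0 - u 0) • (1 : CInterval) + l • coordinate))
    (hmean : mean v = mean u) : l = 0 ∧ v = u := by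
  rw [integralOp_eq_iff] at h
  have hz : ∃ t ∈ Icc (0 : ℝ) 1, v (t : UnitAddCircle) - u (t : UnitAddCircle) = 0 := by
    refine exists_zero_of_integral_eq_zero ((continuous_lift v).sub (continuous_lift u)) ?_
    rw [intervalIntegral.integral_sub ((continuous_lift v).intervalIntegrable _ _)
      ((continuous_lift u).intervalIntegrable _ _), ← mean_eq_integral, ← mean_eq_integral,
      hmean, sub_self]
  obtain ⟨t₀, ht₀, hz⟩ := hz
  have key := eq_of_integral_eq_of_periodic f.contDiff_lift (continuous_lift u)
    (continuous_lift v) (l := l) (fun t ht => ?_) (by rw [coe_one_eq_coe_zero])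
    ⟨t₀, ht₀, sub_eq_zero.1 hz⟩
  · exact ⟨key.1, eq_of_eqOn_period key.2⟩
  · have h1 := h t ht
    rw [ext_onPeriod v ht] at h1
    have h2 : defect f u (onPeriod v) l t = ∫ τ in (0 : ℝ)..t,
        (f.lift (τ, u (τ : UnitAddCircle)) - f.lift (τ, v (τ : UnitAddCircle)) + l) := by
      refine intervalIntegral.integral_congr fun τ hτ => ?_
      rw [uIcc_of_le ht.1] at hτ
      simp only [ext_onPeriod v ⟨hτ.1, hτ.2.trans ht.2⟩]
    rw [← h2, h1]
    simp only [AddCircle.coe_zero]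
    ring

/-- A solution on a period with equal end values extends to a periodic solution. -/
theorem exists_circle_of_integralOp_eq (f : Nonlinearity) (u : C(UnitAddCircle, ℝ))
    {w : CInterval} {c l : ℝ}
    (h : integralOp f.lift f.contDiff_lift.continuous w =
      integralOp f.lift f.contDiff_lift.continuous (onPeriod u) +
        (c • (1 : CInterval) + l • coordinate)) (hper : w 1 = w 0) :
    ∃ x : C(UnitAddCircle, ℝ), onPeriod x = w ∧ ∀ t : ℝ,
      HasDerivAt (fun t : ℝ => x (t : UnitAddCircle) - u (t : UnitAddCircle))
        (f (t : UnitAddCircle) (u t) - f (t : UnitAddCircle) (x t) + l) t := by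
  rw [integralOp_eq_iff] at h
  have hper' : ext w 0 = ext w 1 := by
    rw [ext_of_mem _ (by simp), ext_of_mem _ (by simp)]; exact hper.symm
  set x : C(UnitAddCircle, ℝ) := ⟨AddCircle.liftIco 1 0 (ext w),
    AddCircle.liftIco_zero_continuous hper' (continuous_ext w).continuousOn⟩ with hx
  have hxIco : ∀ t ∈ Ico (0 : ℝ) 1, x (t : UnitAddCircle) = ext w t := fun t ht => by
    have ht' : t ∈ Ico (0 : ℝ) (0 + 1) := by rwa [zero_add]
    exact AddCircle.liftIco_coe_apply (f := ext w) ht'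
  have hxw : ∀ t ∈ Icc (0 : ℝ) 1, x (t : UnitAddCircle) = ext w t := by
    intro t ht
    rcases eq_or_lt_of_le ht.2 with rfl | h1
    · rw [coe_one_eq_coe_zero, hxIco 0 (by simp), hper']
    · exact hxIco t ⟨ht.1, h1⟩
  set q : ℝ → ℝ := fun t =>
    f (t : UnitAddCircle) (u t) - f (t : UnitAddCircle) (x t) + l with hq
  have hqc : Continuous q :=
    (((continuous_nemytskii f u).sub (continuous_nemytskii f x)).add continuous_const).comp
      (AddCircle.continuous_mk' 1)
  have hqper : Function.Periodic q 1 := fun t => by simp [hq]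
  set g : ℝ → ℝ := fun t => c + ∫ τ in (0 : ℝ)..t, q τ with hg
  have hgd : ∀ t, HasDerivAt g (q t) t :=
    fun t => (hqc.integral_hasStrictDerivAt 0 t).hasDerivAt.const_add c
  have hgI : ∀ t ∈ Icc (0 : ℝ) 1, x (t : UnitAddCircle) - u (t : UnitAddCircle) = g t := by
    intro t ht
    rw [hxw t ht, h t ht, add_sub_cancel_left, hg, defect]
    congr 1
    refine intervalIntegral.integral_congr fun τ hτ => ?_
    rw [uIcc_of_le ht.1] at hτ
    simp only [← hxw τ ⟨hτ.1, hτ.2.trans ht.2⟩]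
    rfl
  -- Equal end values mean that the periodic `q` has integral zero. Its primitive `g` is then
  -- periodic, and the identity `x - u = g` spreads from [0,1] to the line, including
  -- differentiability at the integers.
  have hq1 : ∫ τ in (0 : ℝ)..1, q τ = 0 := by
    have h1 := hgI 1 (by simp)
    rw [coe_one_eq_coe_zero, hgI 0 (by simp)] at h1
    simpa [hg] using h1.symm
  have hgper : Function.Periodic g 1 := by
    intro t
    simp only [hg]
    have h1 := intervalIntegral.integral_add_adjacent_intervals
      (hqc.intervalIntegrable 0 t) (hqc.intervalIntegrable (μ := volume) t (t + 1))
    have h2 := hqper.intervalIntegral_add_eq t 0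
    rw [zero_add, hq1] at h2
    rw [← h1, h2, add_zero]
  have hall : ∀ t : ℝ, x (t : UnitAddCircle) - u (t : UnitAddCircle) - g t = 0 := by
    have hp : Function.Periodic
        (fun t : ℝ => x (t : UnitAddCircle) - u (t : UnitAddCircle) - g t) 1 := fun t => by
      simp [hgper t]
    intro t
    obtain ⟨y, hy, hty⟩ := hp.exists_mem_Ico₀ one_pos t
    refine hty.trans ?_
    simp only [hgI y (Ico_subset_Icc_self hy), sub_self]
  refine ⟨x, ?_, fun t => ?_⟩
  · ext t
    rw [← ext_apply w t, ← hxw t t.2]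
    rfl
  · have : (fun t : ℝ => x (t : UnitAddCircle) - u (t : UnitAddCircle)) = g :=
      funext fun t => sub_eq_zero.1 (hall t)
    rw [this]
    exact hgd t

/-! ### Contact with the identity and the common argument -/

theorem iteratedDeriv_const_add_of_pos {g : ℝ → ℝ} (m : ℝ) {i : ℕ} (hi : 1 ≤ i) (x : ℝ) :
    iteratedDeriv i (fun s => m + g s) x = iteratedDeriv i g x := by
  obtain ⟨j, rfl⟩ := Nat.exists_eq_add_of_le' hi
  have h : deriv (fun s => m + g s) = deriv g := funext fun s => deriv_const_add m
  rw [iteratedDeriv_succ', iteratedDeriv_succ', h]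

theorem iteratedDeriv_id_of_two_le {i : ℕ} (hi : 2 ≤ i) (x : ℝ) :
    iteratedDeriv i (id : ℝ → ℝ) x = 0 := by
  obtain ⟨j, rfl⟩ := Nat.exists_eq_add_of_le' hi
  have h : deriv (id : ℝ → ℝ) = fun _ => 1 := funext fun s => deriv_id s
  rw [iteratedDeriv_succ', h, iteratedDeriv_succ', deriv_const']
  simp

/-- Contact with the identity, in terms of derivatives. -/
theorem contact_id_iff {ρ : ℝ → ℝ} {x : ℝ} (hx : ρ x = x) {k : ℕ} (hk : 1 ≤ k) :
    (∀ i ≤ k, iteratedDeriv i ρ x = iteratedDeriv i id x) ↔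
      deriv ρ x = 1 ∧ ∀ i : ℕ, 2 ≤ i → i ≤ k → iteratedDeriv i ρ x = 0 := by
  constructor
  · intro h
    refine ⟨?_, fun i hi hik => ?_⟩
    · have := h 1 hk
      rwa [iteratedDeriv_one, iteratedDeriv_one, deriv_id] at this
    · rw [h i hik, iteratedDeriv_id_of_two_le hi]
  · rintro ⟨h1, h2⟩ i hi
    rcases Nat.lt_or_ge i 2 with hi2 | hi2
    · interval_cases i
      · simpa using hx
      · rw [iteratedDeriv_one, iteratedDeriv_one, deriv_id, h1]
    · rw [h2 i hi2 hi, iteratedDeriv_id_of_two_le hi2]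

/-- The comparison of the return map with the reduced function, for any notion of solution that
amounts to the integral equation. -/
theorem return_map_and_reduced_function (f : Nonlinearity) (u : C(UnitAddCircle, ℝ))
    {Sol : (ℝ → ℝ) → Prop}
    (hSol : ∀ w, Sol w → ∃ X : CInterval, (∀ t : Icc (0 : ℝ) 1, X t = w t) ∧
      integralOp f.lift f.contDiff_lift.continuous X =
        integralOp f.lift f.contDiff_lift.continuous (onPeriod u) +
          ((w 0 - u 0) • (1 : CInterval) + (0 : ℝ) • coordinate))
    (hSol' : ∀ (X : CInterval) (c : ℝ), integralOp f.lift f.contDiff_lift.continuous X =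
        integralOp f.lift f.contDiff_lift.continuous (onPeriod u) +
          (c • (1 : CInterval) + (0 : ℝ) • coordinate) →
      ∃ w, Sol w ∧ ∀ t : Icc (0 : ℝ) 1, w t = X t)
    {B : Type} {S : ℕ → Set B} {b : B} {φ : ℝ → ℝ} {m : ℝ} {good : ℝ → Prop}
    (hS : ∀ k, b ∈ S k ↔ ∀ i : ℕ, 1 ≤ i → i ≤ k → iteratedDeriv i φ 0 = 0)
    (hφ : ∀ (s l : ℝ) (x : C(UnitAddCircle, ℝ)), (∀ t : ℝ,
      HasDerivAt (fun t : ℝ => x (t : UnitAddCircle) - u (t : UnitAddCircle))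
        (f (t : UnitAddCircle) (u t) - f (t : UnitAddCircle) (x t) + l) t) →
      mean x = mean u + s → good s ∧ φ s = m + l) :
    ((∀ᶠ s in 𝓝 (0 : ℝ), good s) ∧ ContDiffAt ℝ ∞ φ 0) ∧
    ((∀ w, Sol w → returnMap Sol (w 0) = w 1) ∧ returnDomain Sol ∈ 𝓝 (u 0) ∧
      ContDiffAt ℝ ∞ (returnMap Sol) (u 0)) ∧
    returnMap Sol (u 0) = u 0 ∧
    (∀ k : ℕ, 1 ≤ k → (b ∈ S k ↔ deriv (returnMap Sol) (u 0) = 1 ∧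
      ∀ i : ℕ, 2 ≤ i → i ≤ k → iteratedDeriv i (returnMap Sol) (u 0) = 0)) ∧
    stratumOrder S b = contactOrder (returnMap Sol) id (u 0) := by
  obtain ⟨P, C, L, hPc, hLc, hL0, hP, hL, hPL⟩ :=
    exists_return_and_periodic_family f.contDiff_lift (onPeriod_one u)
  have huniq : ∀ w, Sol w → returnMap Sol (w 0) = w 1 := by
    intro w hw
    have hex : ∃ w', Sol w' ∧ w' 0 = w 0 := ⟨w, hw, rfl⟩
    rw [returnMap, dif_pos hex]
    obtain ⟨h1, h2⟩ := hex.choose_spec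
    obtain ⟨X, hX, hXe⟩ := hSol _ hw
    obtain ⟨X', hX', hXe'⟩ := hSol _ h1
    rw [h2, ← hXe] at hXe'
    -- The chosen solution and `w` have the same initial value, hence the same image under the
    -- injective integral operator.
    have := injective_integralOp f.contDiff_lift hXe'
    rw [this] at hX'
    exact (hX' 1).symm.trans (hX 1)
  have hfix : returnMap Sol (u 0) = u 0 := by
    obtain ⟨w, hw, hwu⟩ := hSol' (onPeriod u) 0 (by simp)
    have h0 : w 0 = u 0 := hwu 0
    have h1 : w 1 = u 0 := (hwu 1).trans (onPeriod_one u)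
    rw [← h0, huniq w hw, h0, h1]
  have hretP : ∀ᶠ c in 𝓝 (0 : ℝ), u 0 + c ∈ returnDomain Sol ∧
      returnMap Sol (u 0 + c) = u 0 + P c := by
    filter_upwards [hP] with c ⟨X, hX, hX1⟩
    obtain ⟨w, hw, hwX⟩ := hSol' X c hX
    have h0 : w 0 = u 0 + c := (hwX 0).trans (apply_zero_of_integralOp_eq hX)
    have h1 : w 1 = u 0 + P c := by
      have : w 1 = onPeriod u 1 + P c := (hwX 1).trans hX1
      rw [this, onPeriod_one]; rfl
    rw [← h0, huniq w hw]
    exact ⟨⟨w, hw, rfl⟩, h1⟩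
  have hshift : Filter.Tendsto (fun x : ℝ => x - u 0) (𝓝 (u 0)) (𝓝 0) := by
    have hc : Continuous fun x : ℝ => x - u 0 := by fun_prop
    have := hc.tendsto (u 0)
    rwa [sub_self] at this
  have hret := hshift.eventually hretP
  simp only [add_sub_cancel] at hret
  have hρP : returnMap Sol =ᶠ[𝓝 (u 0)] fun x => u 0 + P (x - u 0) := hret.mono fun x hx => hx.2
  have hρc : ContDiffAt ℝ ∞ (returnMap Sol) (u 0) := by
    refine ContDiffAt.congr_of_eventuallyEq ?_ hρP
    refine contDiffAt_const.add ?_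
    have hPc' : ContDiffAt ℝ ∞ P (u 0 - u 0) := by rwa [sub_self]
    exact ContDiffAt.comp (g := P) (f := fun x => x - u 0) (u 0) hPc'
      (contDiffAt_id.sub contDiffAt_const)
  have hφL : ∀ᶠ s in 𝓝 (0 : ℝ), good s ∧ φ s = m + L s := by
    filter_upwards [hL] with s ⟨X, hX, hper, hmean⟩
    obtain ⟨x, hxX, hxd⟩ := exists_circle_of_integralOp_eq f u hX hper
    refine hφ s (L s) x hxd ?_
    rw [mean_eq_primitive, mean_eq_primitive, hxX, hmean]
  have hφe : φ =ᶠ[𝓝 0] fun s => m + L s := hφL.mono fun s hs => hs.2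
  have hcontact : ∀ k, b ∈ S k ↔
      ∀ i ≤ k, iteratedDeriv i (returnMap Sol) (u 0) = iteratedDeriv i id (u 0) := by
    intro k
    -- The strata start at order 1, since φ has an arbitrary value `m` at 0; for `L` order 0 is free
    -- because `L 0 = 0`.
    have h1 : b ∈ S k ↔ ∀ i ≤ k, iteratedDeriv i L 0 = 0 := by
      rw [hS]
      have he : ∀ i, 1 ≤ i → iteratedDeriv i φ 0 = iteratedDeriv i L 0 := fun i hi => by
        rw [(hφe.iteratedDeriv i).eq_of_nhds, iteratedDeriv_const_add_of_pos m hi]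
      constructor
      · intro h i hi
        rcases Nat.eq_zero_or_pos i with rfl | hi0
        · simpa using hL0
        · rw [← he i hi0, h i hi0 hi]
      · intro h i hi0 hi
        rw [he i hi0, h i hi]
    have h2 : (∀ i ≤ k, iteratedDeriv i (returnMap Sol) (u 0) = iteratedDeriv i id (u 0)) ↔
        ∀ i ≤ k, iteratedDeriv i (returnMap Sol - id) (u 0) = 0 := by
      refine forall₂_congr fun i _ => ?_
      have hle : (i : WithTop ℕ∞) ≤ ∞ := by exact_mod_cast le_top
      rw [iteratedDeriv_sub (hρc.of_le hle) (contDiffAt_id.of_le hle), sub_eq_zero]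
    have hρid : ContDiffAt ℝ ∞ (returnMap Sol - id) (u 0) := hρc.sub contDiffAt_id
    rw [h1, h2, iteratedDeriv_eq_zero_iff_isLittleO hLc,
      iteratedDeriv_eq_zero_iff_isLittleO hρid]
    simp only [sub_zero]
    rw [← hPL k]
    have hmap : Filter.map (fun c => u 0 + c) (𝓝 (0 : ℝ)) = 𝓝 (u 0) := by
      simp
    rw [← hmap, Asymptotics.isLittleO_map]
    refine Asymptotics.isLittleO_congr ?_ (Filter.Eventually.of_forall fun c => by simp)
    filter_upwards [hretP] with c hc
    simp [hc.2]
  refine ⟨⟨hφL.mono fun s hs => hs.1, ?_⟩, ⟨huniq, ?_, hρc⟩, hfix, fun k hk => ?_, ?_⟩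
  · exact (contDiffAt_const.add hLc).congr_of_eventuallyEq hφe
  · exact hret.mono fun x hx => hx.1
  · rw [hcontact k, contact_id_iff hfix hk]
  · simp only [stratumOrder, contactOrder, hcontact]

/-! ### Continuous right-hand sides -/

theorem C1Circle.hasDerivAt (u : C1Circle) (t : ℝ) :
    HasDerivAt (fun s : ℝ => u.1 (s : UnitAddCircle)) (circleDeriv u.1 t) t := by
  rw [circleDeriv_coe]
  exact (u.2.differentiable one_ne_zero t).hasDerivAt

theorem opC_apply (f : Nonlinearity) (u : C1Circle) (x : UnitAddCircle) :
    opC f u x = circleDeriv u.1 x + f x (u.1 x) := rfl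

theorem sub_defect_const_of_hasDerivWithinAt (f : Nonlinearity) (u : C1Circle) {w : ℝ → ℝ}
    {X : CInterval} (hX : ∀ t : Icc (0 : ℝ) 1, X t = w t) {l : ℝ}
    (hw : ∀ t ∈ Icc (0 : ℝ) 1, HasDerivWithinAt w
      (circleDeriv u.1 t + (f t (u.1 t) - f t (w t) + l)) (Icc 0 1) t) :
    ∃ K, ∀ t ∈ Icc (0 : ℝ) 1, ext X t - u.1 (t : UnitAddCircle) - defect f u.1 X l t = K := by
  have hXw : ∀ t ∈ Icc (0 : ℝ) 1, ext X t = w t := fun t ht => by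
    rw [ext_of_mem _ ht, hX]
  have hd : ∀ t ∈ Icc (0 : ℝ) 1, HasDerivWithinAt
      (fun t => w t - u.1 (t : UnitAddCircle) - defect f u.1 X l t) 0 (Icc 0 1) t := by
    intro t ht
    refine (((hw t ht).sub (u.hasDerivAt t).hasDerivWithinAt).sub
      (hasDerivAt_defect f u.1 X l t).hasDerivWithinAt).congr_deriv ?_
    rw [hXw t ht]
    simp only [Nonlinearity.lift]
    ring
  refine ⟨w 0 - u.1 ((0 : ℝ) : UnitAddCircle) - defect f u.1 X l 0, fun t ht => ?_⟩
  rw [hXw t ht]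
  exact constant_of_derivWithin_zero
    (f := fun t => w t - u.1 (t : UnitAddCircle) - defect f u.1 X l t) (fun t ht => (hd t ht).differentiableWithinAt)
    (fun t ht => (hd t (Ico_subset_Icc_self ht)).derivWithin
      (uniqueDiffOn_Icc one_pos t (Ico_subset_Icc_self ht))) t ht

theorem integralOp_of_isSolutionC (f : Nonlinearity) (u : C1Circle) {w : ℝ → ℝ}
    (hw : IsSolutionC f (opC f u) w) : ∃ X : CInterval, (∀ t : Icc (0 : ℝ) 1, X t = w t) ∧
      integralOp f.lift f.contDiff_lift.continuous X =
        integralOp f.lift f.contDiff_lift.continuous (onPeriod u.1) +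
          ((w 0 - u.1 0) • (1 : CInterval) + (0 : ℝ) • coordinate) := by
  have hc : ContinuousOn w (Icc 0 1) := fun t ht => (hw t ht).continuousWithinAt
  refine ⟨⟨fun t => w t, continuousOn_iff_continuous_domRestrict.1 hc⟩, fun t => rfl, ?_⟩
  refine integralOp_eq_of_const f u.1 _ 0
    (sub_defect_const_of_hasDerivWithinAt f u (fun t => rfl) fun t ht => ?_)
  refine (hw t ht).congr_deriv ?_
  simp only [opC_apply]
  ring

theorem exists_isSolutionC (f : Nonlinearity) (u : C1Circle) {X : CInterval} {c : ℝ}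
    (h : integralOp f.lift f.contDiff_lift.continuous X =
        integralOp f.lift f.contDiff_lift.continuous (onPeriod u.1) +
          (c • (1 : CInterval) + (0 : ℝ) • coordinate)) :
    ∃ w, IsSolutionC f (opC f u) w ∧ ∀ t : Icc (0 : ℝ) 1, w t = X t := by
  rw [integralOp_eq_iff] at h
  refine ⟨fun t => u.1 (t : UnitAddCircle) + (c + defect f u.1 X 0 t), fun t ht => ?_,
    fun t => (h t t.2).symm.trans (ext_apply X t)⟩
  refine ((u.hasDerivAt t).add
    ((hasDerivAt_defect f u.1 X 0 t).const_add c)).hasDerivWithinAt.congr_deriv ?_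
  simp only [← h t ht, opC_apply, Nonlinearity.lift]
  ring

theorem mean_add_constC (g : C(UnitAddCircle, ℝ)) (l : ℝ) : mean ⇑(g + constC l) = mean g + l := by
  rw [mean_eq_integral, mean_eq_integral]
  simp only [ContinuousMap.add_apply, constC, ContinuousMap.const_apply]
  rw [intervalIntegral.integral_add ((continuous_lift g).intervalIntegrable _ _)
    intervalIntegrable_const]
  simp

theorem constC_add (a b : ℝ) : constC (a + b) = constC a + constC b := rfl

theorem mean_psiC (f : Nonlinearity) (u : C1Circle) : mean (psiC f u) = mean u.1 := by
  have h : psiC f u = opC f u + constC (-mean (opC f u) + mean u.1) := by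
    ext x
    simp [psiC, constC]
    ring
  rw [h, mean_add_constC]
  ring

/-- If Ψ(u) = Ψ(v), then u and v have the same average and F(v) - F(u) is a constant `l`, so
uniqueness with unknown constant forcing applies. -/
theorem psiC_injective (f : Nonlinearity) : Function.Injective (psiC f) := by
  intro u v h
  have hmean : mean v.1 = mean u.1 := by rw [← mean_psiC, ← mean_psiC, h]
  set l := mean (opC f v) - mean (opC f u) with hl
  have hop : ∀ x, opC f v x = opC f u x + l := by
    intro x
    have := congrArg (fun g : C(UnitAddCircle, ℝ) => g x) h
    simp only [psiC, constC, ContinuousMap.add_apply, ContinuousMap.sub_apply,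
      ContinuousMap.const_apply] at this
    rw [hl]
    linarith
  have hint := integralOp_eq_of_const f u.1 (onPeriod v.1) l
    (sub_defect_const_of_hasDerivWithinAt f u (fun t => rfl) fun t ht => by
      refine (v.hasDerivAt t).hasDerivWithinAt.congr_deriv ?_
      have := hop t
      simp only [opC_apply] at this
      linarith)
  exact (Subtype.ext (eq_of_integralOp_eq_of_mean_eq f hint hmean).2).symm

/-- The hypothesis says F(x) = F(u) + l, so F(x) and F(u) have the same part of average zero and
Ψ(x) = Ψ(u) + s. Injectivity of Ψ then identifies the chosen preimage with `x`. -/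
theorem psiC_phiC_of_hasDerivAt (f : Nonlinearity) (u : C1Circle) (s l : ℝ)
    (x : C(UnitAddCircle, ℝ)) (hx : ∀ t : ℝ,
      HasDerivAt (fun t : ℝ => x (t : UnitAddCircle) - u.1 (t : UnitAddCircle))
        (f (t : UnitAddCircle) (u.1 t) - f (t : UnitAddCircle) (x t) + l) t)
    (hmean : mean x = mean u.1 + s) :
    psiC f u + constC s ∈ range (psiC f) ∧
      phiC f (psiC f u + constC s) = mean (opC f u) + l := by
  have hxd : ∀ t : ℝ, HasDerivAt (fun t : ℝ => x (t : UnitAddCircle))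
      (circleDeriv u.1 t + (f (t : UnitAddCircle) (u.1 t) - f (t : UnitAddCircle) (x t) + l)) t := by
    intro t
    refine ((u.hasDerivAt t).add (hx t)).congr_of_eventuallyEq (Filter.Eventually.of_forall ?_)
    intro t
    simp
  have hxc : ContDiff ℝ 1 (fun t : ℝ => x (t : UnitAddCircle)) := by
    refine contDiff_one_iff_deriv.2 ⟨fun t => (hxd t).differentiableAt, ?_⟩
    have : deriv (fun t : ℝ => x (t : UnitAddCircle)) = fun t : ℝ =>
        opC f u t - f (t : UnitAddCircle) (x t) + l := by
      funext t
      rw [(hxd t).deriv]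
      simp only [opC_apply]
      ring
    rw [this]
    exact ((continuous_lift (opC f u)).sub
      ((continuous_nemytskii f x).comp (AddCircle.continuous_mk' 1))).add continuous_const
  set y : C1Circle := ⟨x, hxc⟩ with hy
  have hop : opC f y = opC f u + constC l := by
    refine eq_of_eqOn_period fun t _ => ?_
    simp only [opC_apply, ContinuousMap.add_apply, constC,
      ContinuousMap.const_apply]
    rw [circleDeriv_coe, (hxd t).deriv]
    ring
  have hpsi : psiC f y = psiC f u + constC s := by
    have hm : mean (opC f y) = mean (opC f u) + l := by rw [hop, mean_add_constC]
    rw [psiC, hm, hop, psiC, show mean y.1 = mean u.1 + s from hmean, constC_add, constC_add]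
    abel
  refine ⟨⟨y, hpsi⟩, ?_⟩
  rw [phiC, ← hpsi, Function.leftInverse_invFun (psiC_injective f) y, hop, mean_add_constC]

/-! ### Square integrable right-hand sides -/

theorem ae_period_of_ae_circle {p : UnitAddCircle → Prop}
    (h : ∀ᵐ x ∂(volume : Measure UnitAddCircle), p x) :
    ∀ᵐ t : ℝ, t ∈ Icc (0 : ℝ) 1 → p (t : UnitAddCircle) := by
  have hm := UnitAddCircle.measurePreserving_mk 0
  rw [zero_add] at hm
  have := hm.quasiMeasurePreserving.ae h
  rw [restrict_Ioc_eq_restrict_Icc] at this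
  exact (ae_restrict_iff' measurableSet_Icc).1 this

/-- The measurable equivalence with (0,1] transports null sets without any measurability assumption
on `p`. -/
theorem ae_circle_of_ae_period {p : UnitAddCircle → Prop}
    (h : ∀ᵐ t : ℝ, t ∈ Icc (0 : ℝ) 1 → p (t : UnitAddCircle)) :
    ∀ᵐ x ∂(volume : Measure UnitAddCircle), p x := by
  set e := AddCircle.measurableEquivIoc (1 : ℝ) 0 with he
  have hcoe : (fun t : Ioc (0 : ℝ) (0 + 1) => ((t : ℝ) : UnitAddCircle)) = e.symm := rfl
  have hm := (UnitAddCircle.measurePreserving_mk 0).map_eq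
  rw [← map_comap_subtype_coe measurableSet_Ioc, Measure.map_map AddCircle.measurable_mk'
    measurable_subtype_coe] at hm
  rw [← hm]
  have h1 : ((↑) : ℝ → UnitAddCircle) ∘ (Subtype.val : Ioc (0 : ℝ) (0 + 1) → ℝ) = e.symm := hcoe
  rw [h1, e.symm.measurableEmbedding.ae_map_iff]
  rw [ae_iff] at h ⊢
  rw [comap_subtype_coe_apply measurableSet_Ioc]
  refine measure_mono_null ?_ h
  rintro _ ⟨t, ht, rfl⟩
  have ht' : (t : ℝ) ∈ Ioc (0 : ℝ) 1 := by simpa only [zero_add] using t.2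
  exact fun hp => ht (hp (Ioc_subset_Icc_self ht'))

theorem H1Circle.ae_hasDerivAt (u : H1Circle) :
    ∀ᵐ t : ℝ, t ∈ Icc (0 : ℝ) 1 →
      HasDerivAt (fun s : ℝ => u.1 (s : UnitAddCircle)) (circleDeriv u.1 t) t := by
  filter_upwards [u.2.1.ae_differentiableAt] with t ht hI
  rw [circleDeriv_coe]
  exact (ht (by rwa [uIcc_of_le zero_le_one])).hasDerivAt

theorem absolutelyContinuous_defect (f : Nonlinearity) (u : C(UnitAddCircle, ℝ)) (X : CInterval)
    (l : ℝ) : AbsolutelyContinuousOnInterval (defect f u X l) 0 1 :=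
  ((continuous_defect_integrand f u X l).intervalIntegrable _ _
    ).absolutelyContinuousOnInterval_intervalIntegral (by simp)

/-- Absolute continuity is what turns an almost everywhere vanishing derivative into constancy. -/
theorem sub_defect_const_of_ae_hasDerivAt (f : Nonlinearity) (u : H1Circle) {w : ℝ → ℝ}
    {X : CInterval} (hX : ∀ t : Icc (0 : ℝ) 1, X t = w t) {l : ℝ}
    (hac : AbsolutelyContinuousOnInterval w 0 1)
    (hw : ∀ᵐ t : ℝ, t ∈ Icc (0 : ℝ) 1 → HasDerivAt w
      (circleDeriv u.1 t + (f t (u.1 t) - f t (w t) + l)) t) :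
    ∃ K, ∀ t ∈ Icc (0 : ℝ) 1, ext X t - u.1 (t : UnitAddCircle) - defect f u.1 X l t = K := by
  have hXw : ∀ t ∈ Icc (0 : ℝ) 1, ext X t = w t := fun t ht => by
    rw [ext_of_mem _ ht, hX]
  obtain ⟨K, hK⟩ := ((hac.sub u.2.1).sub
    (absolutelyContinuous_defect f u.1 X l)).const_of_ae_hasDerivAt_zero (by
      filter_upwards [hw, u.ae_hasDerivAt] with t h1 h2 ht
      rw [uIcc_of_le zero_le_one] at ht
      refine (((h1 ht).sub (h2 ht)).sub (hasDerivAt_defect f u.1 X l t)).congr_deriv ?_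
      rw [hXw t ht]
      simp only [Nonlinearity.lift]
      ring)
  refine ⟨K, fun t ht => ?_⟩
  rw [hXw t ht]
  exact hK t (by rwa [uIcc_of_le zero_le_one])

theorem ae_opH (f : Nonlinearity) (u : H1Circle) : ∀ᵐ t : ℝ, t ∈ Icc (0 : ℝ) 1 →
    opH f u (t : UnitAddCircle) = circleDeriv u.1 t + f t (u.1 t) :=
  ae_period_of_ae_circle (memLp_odeOp f u).coeFn_toLp

theorem integralOp_of_isSolutionH (f : Nonlinearity) (u : H1Circle) {w : ℝ → ℝ}
    (hw : IsSolutionH f (opH f u) w) : ∃ X : CInterval, (∀ t : Icc (0 : ℝ) 1, X t = w t) ∧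
      integralOp f.lift f.contDiff_lift.continuous X =
        integralOp f.lift f.contDiff_lift.continuous (onPeriod u.1) +
          ((w 0 - u.1 0) • (1 : CInterval) + (0 : ℝ) • coordinate) := by
  have hc : ContinuousOn w (Icc 0 1) := by
    simpa [uIcc_of_le (zero_le_one' ℝ)] using hw.1.continuousOn
  refine ⟨⟨fun t => w t, continuousOn_iff_continuous_domRestrict.1 hc⟩, fun t => rfl, ?_⟩
  refine integralOp_eq_of_const f u.1 _ 0
    (sub_defect_const_of_ae_hasDerivAt f u (fun t => rfl) hw.1 ?_)
  filter_upwards [(ae_restrict_iff' measurableSet_Icc).1 hw.2, ae_opH f u] with t h1 h2 ht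
  refine (h1 ht).congr_deriv ?_
  rw [h2 ht]
  ring

theorem exists_isSolutionH (f : Nonlinearity) (u : H1Circle) {X : CInterval} {c : ℝ}
    (h : integralOp f.lift f.contDiff_lift.continuous X =
        integralOp f.lift f.contDiff_lift.continuous (onPeriod u.1) +
          (c • (1 : CInterval) + (0 : ℝ) • coordinate)) :
    ∃ w, IsSolutionH f (opH f u) w ∧ ∀ t : Icc (0 : ℝ) 1, w t = X t := by
  rw [integralOp_eq_iff] at h
  refine ⟨fun t => u.1 (t : UnitAddCircle) + (c + defect f u.1 X 0 t), ⟨?_, ?_⟩,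
    fun t => (h t t.2).symm.trans (ext_apply X t)⟩
  · have hc : AbsolutelyContinuousOnInterval (fun _ : ℝ => c) 0 1 :=
      ((LipschitzWith.const c).lipschitzOnWith (s := uIcc 0 1)).absolutelyContinuousOnInterval
    exact u.2.1.add (hc.add (absolutelyContinuous_defect f u.1 X 0))
  · refine (ae_restrict_iff' measurableSet_Icc).2 ?_
    filter_upwards [u.ae_hasDerivAt, ae_opH f u] with t h1 h2 ht
    refine ((h1 ht).add ((hasDerivAt_defect f u.1 X 0 t).const_add c)).congr_deriv ?_
    simp only [← h t ht, h2 ht, Nonlinearity.lift]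
    ring

theorem coeFn_add_constH (g : L2Circle) (l : ℝ) :
    (g + constH l : L2Circle) =ᵐ[volume] fun x => g x + l := by
  filter_upwards [Lp.coeFn_add g (constH l), Lp.coeFn_const (μ := (volume : Measure UnitAddCircle))
    (p := 2) (c := l)] with x h1 h2
  rw [h1, Pi.add_apply, constH, h2]
  rfl

theorem mean_add_constH (g : L2Circle) (l : ℝ) : mean (g + constH l : L2Circle) = mean g + l := by
  rw [mean, integral_congr_ae (coeFn_add_constH g l), integral_add
    ((Lp.memLp g).integrable one_le_two) (integrable_const l)]
  simp [mean, measureReal_def]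

theorem constH_add (a b : ℝ) : constH (a + b) = constH a + constH b := map_add _ _ _

theorem constH_neg (a : ℝ) : constH (-a) = -constH a := map_neg _ _

theorem psiH_eq (f : Nonlinearity) (u : H1Circle) :
    psiH f u = opH f u + constH (-mean (opH f u) + mean u.1) := by
  rw [psiH, constH_add, constH_neg]
  abel

theorem mean_psiH (f : Nonlinearity) (u : H1Circle) : mean (psiH f u) = mean u.1 := by
  rw [psiH_eq, mean_add_constH]
  ring

theorem psiH_injective (f : Nonlinearity) : Function.Injective (psiH f) := by
  intro u v h
  have hmean : mean v.1 = mean u.1 := by rw [← mean_psiH, ← mean_psiH, h]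
  set l := mean (opH f v) - mean (opH f u) with hl
  have hop : opH f v = opH f u + constH l := by
    simp only [psiH, hmean, add_left_inj] at h
    rw [hl, sub_eq_add_neg, constH_add, constH_neg, add_comm (constH _), ← add_assoc,
      ← sub_eq_add_neg, h]
    abel
  have hae : ∀ᵐ t : ℝ, t ∈ Icc (0 : ℝ) 1 →
      opH f v (t : UnitAddCircle) = opH f u (t : UnitAddCircle) + l := by
    rw [hop]
    exact ae_period_of_ae_circle (coeFn_add_constH _ _)
  have hint := integralOp_eq_of_const f u.1 (onPeriod v.1) l
    (sub_defect_const_of_ae_hasDerivAt f u (fun t => rfl) v.2.1 (by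
      filter_upwards [v.ae_hasDerivAt, hae, ae_opH f u, ae_opH f v] with t h1 h2 h3 h4 ht
      refine (h1 ht).congr_deriv ?_
      have := h2 ht
      rw [h3 ht, h4 ht] at this
      linarith))
  exact (Subtype.ext (eq_of_integralOp_eq_of_mean_eq f hint hmean).2).symm

theorem psiH_phiH_of_hasDerivAt (f : Nonlinearity) (u : H1Circle) (s l : ℝ)
    (x : C(UnitAddCircle, ℝ)) (hx : ∀ t : ℝ,
      HasDerivAt (fun t : ℝ => x (t : UnitAddCircle) - u.1 (t : UnitAddCircle))
        (f (t : UnitAddCircle) (u.1 t) - f (t : UnitAddCircle) (x t) + l) t)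
    (hmean : mean x = mean u.1 + s) :
    psiH f u + constH s ∈ range (psiH f) ∧
      phiH f (psiH f u + constH s) = mean (opH f u) + l := by
  set q : C(UnitAddCircle, ℝ) := ⟨fun x' => f x' (u.1 x') - f x' (x x') + l,
    ((continuous_nemytskii f u.1).sub (continuous_nemytskii f x)).add continuous_const⟩ with hq
  -- The derivative `q` of `x - u` is continuous, so `x` is a C¹ perturbation of `u` and stays in
  -- H¹.
  have hac : AbsolutelyContinuousOnInterval (fun t : ℝ => x (t : UnitAddCircle)) 0 1 := by
    have h1 : AbsolutelyContinuousOnInterval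
        (fun t : ℝ => x (t : UnitAddCircle) - u.1 (t : UnitAddCircle)) 0 1 := by
      have hc : ContDiff ℝ 1 (fun t : ℝ => x (t : UnitAddCircle) - u.1 (t : UnitAddCircle)) := by
        refine contDiff_one_iff_deriv.2 ⟨fun t => (hx t).differentiableAt, ?_⟩
        rw [funext fun t => (hx t).deriv]
        exact continuous_lift q
      exact hc.contDiffOn.absolutelyContinuousOnInterval
    have h2 := u.2.1.add h1
    have h3 : ((fun t : ℝ => u.1 (t : UnitAddCircle)) +
        fun t : ℝ => x (t : UnitAddCircle) - u.1 (t : UnitAddCircle)) =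
        fun t : ℝ => x (t : UnitAddCircle) := by
      funext t
      simp
    rwa [h3] at h2
  have hcd : circleDeriv x =ᵐ[volume] fun y => circleDeriv u.1 y + q y := by
    refine ae_circle_of_ae_period ?_
    filter_upwards [u.ae_hasDerivAt] with t h1 ht
    rw [circleDeriv_coe x]
    have h2 := (h1 ht).add (hx t)
    have h3 : ((fun t : ℝ => u.1 (t : UnitAddCircle)) +
        fun t : ℝ => x (t : UnitAddCircle) - u.1 (t : UnitAddCircle)) =
        fun t : ℝ => x (t : UnitAddCircle) := by
      funext t
      simp
    rw [h3] at h2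
    exact h2.deriv
  have hmem : MemLp (circleDeriv x) 2 (volume : Measure UnitAddCircle) :=
    (memLp_congr_ae hcd).2 (u.2.2.add (q.memLp volume ℝ))
  set y : H1Circle := ⟨x, hac, hmem⟩ with hy
  have hop : opH f y = opH f u + constH l := by
    refine Lp.ext ?_
    filter_upwards [coeFn_add_constH (opH f u) l, (memLp_odeOp f u).coeFn_toLp,
      (memLp_odeOp f y).coeFn_toLp, hcd] with z h1 h2 h3 h4
    rw [h1, opH, opH, h2, h3, odeOp, odeOp]
    change circleDeriv x z + f z (x z) = _
    rw [h4]
    simp only [hq, ContinuousMap.coe_mk]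
    ring
  have hpsi : psiH f y = psiH f u + constH s := by
    have hm : mean (opH f y) = mean (opH f u) + l := by rw [hop, mean_add_constH]
    rw [psiH, hm, hop, psiH, show mean y.1 = mean u.1 + s from hmean, constH_add, constH_add]
    abel
  refine ⟨⟨y, hpsi⟩, ?_⟩
  rw [phiH, ← hpsi, Function.leftInverse_invFun (psiH_injective f) y, hop, mean_add_constH]

end PeriodicODE

theorem proposition2p3 (f : PeriodicODE.Nonlinearity) :
    -- the `C` case, `F : C¹ → C⁰`
    (∀ (u : PeriodicODE.C1Circle) (v : C(UnitAddCircle, ℝ)) (ρ : ℝ → ℝ),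
      v = PeriodicODE.opC f u → ρ = PeriodicODE.returnMap (PeriodicODE.IsSolutionC f v) →
      -- the adapted coordinates defining `S_k` make sense around `u`
      (Function.Injective (PeriodicODE.psiC f) ∧
        (∀ᶠ s in 𝓝 (0 : ℝ),
          PeriodicODE.psiC f u + PeriodicODE.constC s ∈ range (PeriodicODE.psiC f)) ∧
        ContDiffAt ℝ ∞
          (fun s : ℝ => PeriodicODE.phiC f (PeriodicODE.psiC f u + PeriodicODE.constC s)) 0) ∧
      -- the return map is well defined, and smooth near `u(0)`
      ((∀ w : ℝ → ℝ, PeriodicODE.IsSolutionC f v w → ρ (w 0) = w 1) ∧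
        PeriodicODE.returnDomain (PeriodicODE.IsSolutionC f v) ∈ 𝓝 (u.1 0) ∧
        ContDiffAt ℝ ∞ ρ (u.1 0)) ∧
      ρ (u.1 0) = u.1 0 ∧
      (∀ k : ℕ, 1 ≤ k →
        (u ∈ PeriodicODE.stratumC f k ↔
          deriv ρ (u.1 0) = 1 ∧ ∀ i : ℕ, 2 ≤ i → i ≤ k → iteratedDeriv i ρ (u.1 0) = 0)) ∧
      PeriodicODE.stratumOrder (PeriodicODE.stratumC f) u =
        PeriodicODE.contactOrder ρ id (u.1 0)) ∧
    -- the `H` case, `F : H¹ → L²`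
    (∀ (u : PeriodicODE.H1Circle) (v : PeriodicODE.L2Circle) (ρ : ℝ → ℝ),
      v = PeriodicODE.opH f u → ρ = PeriodicODE.returnMap (PeriodicODE.IsSolutionH f v) →
      (Function.Injective (PeriodicODE.psiH f) ∧
        (∀ᶠ s in 𝓝 (0 : ℝ),
          PeriodicODE.psiH f u + PeriodicODE.constH s ∈ range (PeriodicODE.psiH f)) ∧
        ContDiffAt ℝ ∞
          (fun s : ℝ => PeriodicODE.phiH f (PeriodicODE.psiH f u + PeriodicODE.constH s)) 0) ∧
      ((∀ w : ℝ → ℝ, PeriodicODE.IsSolutionH f v w → ρ (w 0) = w 1) ∧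
        PeriodicODE.returnDomain (PeriodicODE.IsSolutionH f v) ∈ 𝓝 (u.1 0) ∧
        ContDiffAt ℝ ∞ ρ (u.1 0)) ∧
      ρ (u.1 0) = u.1 0 ∧
      (∀ k : ℕ, 1 ≤ k →
        (u ∈ PeriodicODE.stratumH f k ↔
          deriv ρ (u.1 0) = 1 ∧ ∀ i : ℕ, 2 ≤ i → i ≤ k → iteratedDeriv i ρ (u.1 0) = 0)) ∧
      PeriodicODE.stratumOrder (PeriodicODE.stratumH f) u =
        PeriodicODE.contactOrder ρ id (u.1 0)) := by

  refine ⟨?_, ?_⟩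
  · rintro u v ρ rfl rfl
    have h := PeriodicODE.return_map_and_reduced_function f u.1
      (S := PeriodicODE.stratumC f) (b := u) (m := PeriodicODE.mean (PeriodicODE.opC f u))
      (φ := fun s => PeriodicODE.phiC f (PeriodicODE.psiC f u + PeriodicODE.constC s))
      (fun _ => PeriodicODE.integralOp_of_isSolutionC f u)
      (fun _ _ => PeriodicODE.exists_isSolutionC f u) (fun _ => Iff.rfl)
      (PeriodicODE.psiC_phiC_of_hasDerivAt f u)
    exact ⟨⟨PeriodicODE.psiC_injective f, h.1⟩, h.2⟩
  · rintro u v ρ rfl rfl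
    have h := PeriodicODE.return_map_and_reduced_function f u.1
      (S := PeriodicODE.stratumH f) (b := u) (m := PeriodicODE.mean (PeriodicODE.opH f u))
      (φ := fun s => PeriodicODE.phiH f (PeriodicODE.psiH f u + PeriodicODE.constH s))
      (fun _ => PeriodicODE.integralOp_of_isSolutionH f u)
      (fun _ _ => PeriodicODE.exists_isSolutionH f u) (fun _ => Iff.rfl)
      (PeriodicODE.psiH_phiH_of_hasDerivAt f u)
    exact ⟨⟨PeriodicODE.psiH_injective f, h.1⟩, h.2⟩
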